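/- Put $r_0=16,\ r_1=8,\ r_2=4,\ r_3=2,\ r_4=1,\ r_5=0$. Let $P_{33}$ be the space of real polynomials of total degree at most $33$ in five variables, $\dim P_{33}=\binom{38}{5}=501942$. **Node indices.** For $0\le d\le 5$ and $0\le s\le r_d$ let $J_{d,s}$ be the set of $\gamma\in\mathbb N^{d+1}$ (entries indexed by the vertices of a $d$-simplex $F$) with $\sum_i\gamma_i=33-s$ and $s+\sum_{i\notin G}\gamma_i>r_{\dim G}$ for every nonempty proper subface $G$ of $F$. These are the restrictions to $F$ of the Bernstein indices of degree $33$ that lie at distance $s$ from $F$ and are not assigned to a face of lower dimension. **Nodes.** For a spacing $h_{d,s}>0$, the node with index $\gamma\in J_{d,s}$ on a $d$-face $F$ is the point of the affine hull of $F$ with barycentric coordinates $\frac1{d+1}+h_{d,s}\bigl(\gamma_i-\frac{33-s}{d+1}\bigr)$; that is, the nodes form a part of a principal (Lagrange) lattice centred at the barycentre. The spacing is called internal if all these barycentric coordinates are positive. **Degrees of freedom.** On each $d$-dimensional face $F$ of a 5D simplex ($F$ being the simplex itself if $d=5$) fix a basis $n_1,\dots,n_{5-d}$ of the space of vectors orthogonal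 to $F$. The degrees of freedom of $p$ on $F$ are the values of all derivatives $\partial_{n_1}^{\beta_1}\cdots\partial_{n_{5-d}}^{\beta_{5-d}}p$, $|\beta|=s\le r_d$, at the nodes of $F$ with indices in $J_{d,s}$. So they are: all derivatives up to order $16$ at the vertices, and normal derivatives up to order $8$ on edges, $4$ on triangles, $2$ on tetrahedra, $1$ on 4D faces, and $0$ (values) inside. **Theorem.** (1) $|J_{0,s}|=1$ for $s\le16$; $|J_{1,s}|=s$ for $s\le 8$; $|J_{2,s}|=28,45,63,82,102$ for $s=0,\dots,4$; $|J_{3,s}|=544,889,1268$ for $s=0,1,2$; $|J_{4,s}|=6965,12990$ for $s=0,1$; $|J_{5,0}|=62888$. On one 5D simplex the numbers of degrees of freedom on its vertices, edges, triangles, tetrahedra, 4D faces and in its interior are $122094$, $47520$, $57820$, $91890$, $119730$, $62888$, in total $501942=\dim P_{33}$. (2) There are finite sets $Z_{d,s}\subset\mathbb R$ of exceptional spacings, empty if $d\le1$ or if $d=2$, $s\le1$, such that the following hold for every choice of internal spacings $h_{d,s}\notin Z_{d,s}$ ($0\le d\le5$, $0\le s\le r_d$). (a) On every nondegenerate 5D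 simplex, for all choices of the normal bases, the degrees of freedom are unisolvent on $P_{33}$: for every assignment of real values to them there is exactly one $p\in P_{33}$ that takes these values. (b) Let $\mathcal T$ be any finite 5D simplex grid: a finite set of nondegenerate 5D simplices any two of which meet exactly in the simplex (possibly empty) spanned by their common vertices. Fix arbitrary normal bases on its faces. Let $V_h$ be the space of families $(p_K)_{K\in\mathcal T}$, $p_K\in P_{33}$, such that each degree of freedom on a face $F$ has the same value for all $K\supseteq F$. Then $V_h$ is exactly the space of families such that for every face $F$ and all $K,K'\supseteq F$ all partial derivatives of $p_K$ and $p_{K'}$ of order at most $r_{\dim F}$ agree on $F$ ($C^{16}$ at vertices, $C^8$ on edges, $C^4$ on triangles, $C^2$ on tetrahedra, $C^1$ on 4D faces). Every member of $V_h$ is given by a single function which equals $p_K$ on each $K$ and is $C^1$ on $\bigcup_{K\in\mathcal T}K$. And $V_h$ has a nodal basis: a basis indexed by the degrees of freedom of the grid and dual to them. -/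

import Mathlib

noncomputable section

namespace SimplexFE

/-- The ambient space `ℝ⁵`. -/
abbrev E : Type := EuclideanSpace ℝ (Fin 5)

/-- Real polynomials in five variables. -/
abbrev Poly : Type := MvPolynomial (Fin 5) ℝ

/-- The space `P₃₃` of real polynomials in five variables of total degree at most `33`. -/
abbrev P33 : Submodule ℝ Poly := MvPolynomial.restrictTotalDegree (Fin 5) ℝ 33

/-- The order of continuity required on faces of dimension `d`: `16` at vertices, `8` on edges,
`4` on triangles, `2` on tetrahedra, `1` on 4D faces (and nothing extra on the 5D simplex). -/
def smoothness : ℕ → ℕ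
  | 0 => 16
  | 1 => 8
  | 2 => 4
  | 3 => 2
  | 4 => 1
  | _ => 0

/-- Evaluation of a polynomial at a point. -/
def evalAt (y : E) : Poly →ₗ[ℝ] ℝ := (MvPolynomial.aeval (fun i => y i)).toLinearMap

/-- The derivative in direction `v`. -/
def dirDeriv (v : E) : Module.End ℝ Poly :=
  ∑ i : Fin 5, v i • (MvPolynomial.pderiv i : Derivation ℝ Poly Poly).toLinearMap

/-- The iterated derivative `∂_{v 0}^{β 0} ∂_{v 1}^{β 1} ⋯`, of order `β 0 + β 1 + ⋯`. -/
def multiDeriv {k : ℕ} (v : Fin k → E) (β : Fin k → ℕ) : Module.End ℝ Poly :=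
  (List.ofFn fun j => dirDeriv (v j) ^ β j).prod

/-- The partial derivative `∂^α` in the coordinates of `ℝ⁵`. -/
def partialDeriv (α : Fin 5 → ℕ) : Module.End ℝ Poly :=
  multiDeriv (fun i => EuclideanSpace.single i (1 : ℝ)) α

/-- The Bernstein indices belonging to the derivatives of normal order `s` in the interior of a
face with vertex set `τ`, restricted to that face: the multi-indices of length `33 - s` that are
not within distance `smoothness (dim G)` of a proper subface `G`, where the distance to `G` of a
Bernstein index of the 5D simplex is the sum of its entries off `G` (the entries outside the face
sum to `s`). -/
def nodeIndex (τ : Type) [Fintype τ] [DecidableEq τ] (s : ℕ) : Set (τ → ℕ) :=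
  {γ | ∑ i, γ i = 33 - s ∧
    ∀ G : Finset τ, G.Nonempty → G ≠ Finset.univ →
      smoothness (G.card - 1) < s + ∑ i ∈ Gᶜ, γ i}

/-- The `i`-th barycentric coordinate, on a `d`-dimensional face, of the Lagrange node with index
`γ` (`∑ γ = 33 - s`), in the principal lattice with spacing `h` centred at the barycentre. -/
def nodeCoord (d s : ℕ) (h : ℝ) {τ : Type} (γ : τ → ℕ) (i : τ) : ℝ :=
  1 / ((d : ℝ) + 1) + h * ((γ i : ℝ) - ((33 - s : ℕ) : ℝ) / ((d : ℝ) + 1))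

/-- A spacing for which all nodes of normal order `s` lie in the relative interior of
their `d`-dimensional face. -/
def IsInternalSpacing (d s : ℕ) (h : ℝ) : Prop :=
  0 < h ∧ ∀ γ ∈ nodeIndex (Fin (d + 1)) s, ∀ i, 0 < nodeCoord d s h γ i

/-- `F` is a (nonempty) face of one of the cells; cells and faces are given by vertex sets. -/
def IsFace {V : ℕ} (cells : Finset (Finset (Fin V))) (F : Finset (Fin V)) : Prop :=
  F.Nonempty ∧ ∃ K ∈ cells, F ⊆ K

/-- A 5D simplex grid: nondegenerate 5-simplices, any two of which intersect exactly in the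
simplex spanned by their common vertices. -/
structure IsSimplexGrid {V : ℕ} (x : Fin V → E) (cells : Finset (Finset (Fin V))) : Prop where
  card_eq : ∀ K ∈ cells, K.card = 6
  affineIndependent : ∀ K ∈ cells, AffineIndependent ℝ (fun i : K => x i)
  inter_eq : ∀ K ∈ cells, ∀ K' ∈ cells,
    convexHull ℝ (x '' (K : Set (Fin V))) ∩ convexHull ℝ (x '' (K' : Set (Fin V))) =
      convexHull ℝ (x '' ((K ∩ K' : Finset (Fin V)) : Set (Fin V)))

/-- `ν F` is a basis of the `6 - F.card = 5 - dim F` dimensional space of vectors orthogonal to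
the face `F`, for every face `F`. -/
def IsNormalFrame {V : ℕ} (x : Fin V → E) (cells : Finset (Finset (Fin V)))
    (ν : (F : Finset (Fin V)) → Fin (6 - F.card) → E) : Prop :=
  ∀ F, IsFace cells F → LinearIndependent ℝ (ν F) ∧
    ∀ j, ∀ a ∈ F, ∀ b ∈ F, inner ℝ (ν F j) (x a - x b) = 0

/-- The degrees of freedom: a face, a multi-index of normal derivatives of
order at most the smoothness required there, and an interior node of the face. -/
structure Dof {V : ℕ} (cells : Finset (Finset (Fin V))) where
  face : Finset (Fin V)
  isFace : IsFace cells face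
  normal : Fin (6 - face.card) → ℕ
  order_le : ∑ j, normal j ≤ smoothness (face.card - 1)
  node : face → ℕ
  node_mem : node ∈ nodeIndex face (∑ j, normal j)

namespace Dof

variable {V : ℕ} {cells : Finset (Finset (Fin V))}

/-- The dimension of the face carrying a degree of freedom. -/
def dim (δ : Dof cells) : ℕ := δ.face.card - 1

/-- The order of the normal derivative in a degree of freedom. -/
def order (δ : Dof cells) : ℕ := ∑ j, δ.normal j

/-- The point at which the degree of freedom is evaluated; `h d s` is the lattice spacing used
for normal derivatives of order `s` on faces of dimension `d`. -/
def point (δ : Dof cells) (x : Fin V → E) (h : ℕ → ℕ → ℝ) : E :=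
  ∑ i : δ.face, nodeCoord δ.dim δ.order (h δ.dim δ.order) δ.node i • x i

/-- The functional: a normal derivative at a node. -/
def functional (δ : Dof cells) (x : Fin V → E)
    (ν : (F : Finset (Fin V)) → Fin (6 - F.card) → E) (h : ℕ → ℕ → ℝ) : Poly →ₗ[ℝ] ℝ :=
  evalAt (δ.point x h) ∘ₗ multiDeriv (ν δ.face) δ.normal

end Dof

/-- Piecewise `P₃₃` functions: a polynomial for each cell. -/
abbrev Piecewise {V : ℕ} (cells : Finset (Finset (Fin V))) : Type := cells → P33

/-- The global finite element space: the piecewise `P₃₃` functions for which every degree of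
freedom takes the same value on all cells that contain its face. -/
def femSpace {V : ℕ} (x : Fin V → E) (cells : Finset (Finset (Fin V)))
    (ν : (F : Finset (Fin V)) → Fin (6 - F.card) → E) (h : ℕ → ℕ → ℝ) :
    Submodule ℝ (Piecewise cells) where
  carrier := {v | ∀ δ : Dof cells, ∀ K K' : cells, δ.face ⊆ K.1 → δ.face ⊆ K'.1 →
    δ.functional x ν h (v K : Poly) = δ.functional x ν h (v K' : Poly)}
  add_mem' := by
    intro v w hv hw δ K K' hK hK'
    simp [hv δ K K' hK hK', hw δ K K' hK hK']
  zero_mem' := by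
    intro δ K K' _ _
    simp
  smul_mem' := by
    intro c v hv δ K K' hK hK'
    simp [hv δ K K' hK hK']

/-- The superspline space: the piecewise `P₃₃` functions that are continuous of order
`smoothness (dim F)` on every face `F`, i.e. all partial derivatives up to this order of the
polynomials on the cells containing `F` agree at all points of `F`. -/
def superSplineSpace {V : ℕ} (x : Fin V → E) (cells : Finset (Finset (Fin V))) :
    Submodule ℝ (Piecewise cells) where
  carrier := {v | ∀ F, IsFace cells F → ∀ K K' : cells, F ⊆ K.1 → F ⊆ K'.1 →
    ∀ α : Fin 5 → ℕ, ∑ i, α i ≤ smoothness (F.card - 1) →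
      ∀ y ∈ convexHull ℝ (x '' (F : Set (Fin V))),
        evalAt y (partialDeriv α (v K : Poly)) = evalAt y (partialDeriv α (v K' : Poly))}
  add_mem' := by
    intro v w hv hw F hF K K' hK hK' α hα y hy
    simp [hv F hF K K' hK hK' α hα y hy, hw F hF K K' hK hK' α hα y hy]
  zero_mem' := by
    intro F _ K K' _ _ α _ y _
    simp
  smul_mem' := by
    intro c v hv F hF K K' hK hK' α hα y hy
    simp [hv F hF K K' hK hK' α hα y hy]

/-- The domain covered by the grid. -/
def domain {V : ℕ} (x : Fin V → E) (cells : Finset (Finset (Fin V))) : Set E :=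
  ⋃ K ∈ cells, convexHull ℝ (x '' (K : Set (Fin V)))

/-- The one-cell grid on six vertices. -/
abbrev oneCell : Finset (Finset (Fin 6)) := {Finset.univ}

end SimplexFE

end

open SimplexFE

/-! In barycentric coordinates a polynomial of degree at most 33 becomes a form of degree 33, and
vanishing to order `s` along a face F means that every monomial has total exponent at least `s` in
the variables off F (`orderAlong`). Suppose that all degrees of freedom on a face and its subfaces
vanish. Take these faces by increasing inclusion, and on each face F take the normal orders `s` in
turn. If the form vanishes to order `s` along F, its terms of exact order `s` are monomials in the
variables off F times forms of degree 33 - s in the variables of F (`slice`). The vanishing already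
known on the proper subfaces puts the exponents of these forms into `nodeIndex`. The normal
derivatives of order `s` make them zero at the nodes, since normal and tangential directions
together span everything (`Barycentric.eval_slice_eq_zero`). If interpolation at the nodes is
unisolvent for these exponents, the slices vanish and the order rises by one
(`mem_orderAlong_of_functional_eq_zero`).

On a whole cell this shows that the form is zero, and the number of functionals equals the
dimension, so the local problem is bijective (`localDofs_bijective`). Applied to the difference of
the polynomials of two cells and a common face, the same argument gives conformity. The nodal basis
comes from gluing local solutions, and C¹ holds because distinct cells meet in dimension at most 4.

What remains is interpolation at the nodes, where the index sets are in general lattices with parts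
cut away. The collocation determinant is a polynomial in the spacing, so one good spacing leaves
only finitely many bad ones. Up to a scalar the nodes are 1 + εγ', and the matrix is (1 + εγ')^γ.
Binomial expansion writes it through moments with a triangular coefficient array; after the
substitution ε = η² and a rescaling of the moments, its quadratic form is a small perturbation of a
positive diagonal one (`exists_kernel_nondegenerate`). When the index set is a full lattice,
explicit Lagrange products work for every internal spacing (`nodalUnisolvent_of_full`).

The node counts are digits of powers of generating functions evaluated at a large power of 2. -/

namespace SimplexFE

set_option linter.unusedSectionVars false

/-! ### Nondegeneracy of the kernel (1 + εγ')^γ for a suitable ε -/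

section Kernel

/-- A continuous family of quadratic forms that is diagonal and positive at `0` stays definite. -/
theorem exists_pos_quadratic_definite {κ : Type*} [DecidableEq κ] (B : Finset κ)
    (A : κ → κ → ℝ → ℝ) (hA : ∀ k l, Continuous (A k l)) (c : ℝ) (hc : 0 < c)
    (hd : ∀ k ∈ B, c ≤ A k k 0) (ho : ∀ k ∈ B, ∀ l ∈ B, k ≠ l → A k l 0 = 0) :
    ∃ η : ℝ, 0 < η ∧ ∀ m : κ → ℝ, ∑ k ∈ B, ∑ l ∈ B, A k l η * m k * m l ≤ 0 →
      ∀ k ∈ B, m k = 0 := by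
  -- With this margin the perturbation costs at most `δ * B.card` times the sum of squares, which is
  -- less than half of `c`.
  set δ : ℝ := c / (2 * (B.card + 1)) with hδ
  have hδ0 : 0 < δ := by positivity
  have hev : ∀ᶠ η in nhds (0 : ℝ), ∀ k ∈ B, ∀ l ∈ B, |A k l η - A k l 0| < δ := by
    simp only [Finset.eventually_all]
    intro k _ l _
    have := Metric.tendsto_nhds.1 ((hA k l).tendsto 0) δ hδ0
    simpa [Real.dist_eq] using this
  obtain ⟨η, hη, hη0⟩ :=
    ((hev.filter_mono nhdsWithin_le_nhds).and (self_mem_nhdsWithin (s := Set.Ioi (0 : ℝ)))).exists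
  refine ⟨η, hη0, fun m hm => ?_⟩
  have key : ∀ k ∈ B, ∀ l ∈ B,
      (if k = l then c * m k ^ 2 else 0) - δ * ((m k ^ 2 + m l ^ 2) / 2) ≤
        A k l η * m k * m l := by
    intro k hk l hl
    have h1 := hη k hk l hl
    have h2 : |m k * m l| ≤ (m k ^ 2 + m l ^ 2) / 2 := by
      rw [abs_le]
      constructor <;> nlinarith [sq_nonneg (m k + m l), sq_nonneg (m k - m l)]
    have h3 : |(A k l η - A k l 0) * (m k * m l)| ≤ δ * ((m k ^ 2 + m l ^ 2) / 2) := by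
      rw [abs_mul]
      exact mul_le_mul h1.le h2 (abs_nonneg _) hδ0.le
    have h4 := neg_le_of_abs_le h3
    have h5 : (if k = l then c * m k ^ 2 else 0) ≤ A k l 0 * (m k * m l) := by
      split_ifs with h
      · subst h
        have := mul_le_mul_of_nonneg_right (hd k hk) (sq_nonneg (m k))
        nlinarith
      · rw [ho k hk l hl h, zero_mul]
    linarith [mul_assoc (A k l η) (m k) (m l), sub_mul (A k l η) (A k l 0) (m k * m l)]
  have hsum := Finset.sum_le_sum fun k hk => Finset.sum_le_sum fun l hl => key k hk l hl
  have hcalc : ∑ k ∈ B, ∑ l ∈ B,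
      ((if k = l then c * m k ^ 2 else 0) - δ * ((m k ^ 2 + m l ^ 2) / 2)) =
        (c - δ * B.card) * ∑ k ∈ B, m k ^ 2 := by
    simp only [Finset.sum_sub_distrib, ← Finset.mul_sum, ← Finset.sum_div, Finset.sum_add_distrib,
      Finset.sum_const, nsmul_eq_mul]
    have : ∑ x ∈ B, ∑ y ∈ B, (if x = y then c * m x ^ 2 else 0) = c * ∑ k ∈ B, m k ^ 2 := by
      rw [Finset.mul_sum]
      refine Finset.sum_congr rfl fun x hx => ?_
      rw [Finset.sum_ite_eq, if_pos hx]
    rw [this]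
    ring
  have hpos : 0 < c - δ * B.card := by
    have : δ * (2 * (B.card + 1)) = c := by rw [hδ]; field_simp
    nlinarith
  have hz : ∑ k ∈ B, m k ^ 2 ≤ 0 := by
    by_contra! h
    have := mul_pos hpos h
    linarith
  have hz' := (Finset.sum_eq_zero_iff_of_nonneg fun k _ => sq_nonneg (m k)).1
    (le_antisymm hz (Finset.sum_nonneg fun k _ => sq_nonneg _))
  exact fun k hk => by simpa using hz' k hk

/-- The coefficients of the polynomial `x ↦ x.choose k`. -/
noncomputable def chooseCoeff (k l : ℕ) : ℝ := (descPochhammer ℝ k).coeff l / (k.factorial : ℝ)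

theorem chooseCoeff_self (k : ℕ) : chooseCoeff k k = 1 / (k.factorial : ℝ) := by
  have h := monic_descPochhammer ℝ k
  rw [Polynomial.Monic, Polynomial.leadingCoeff, descPochhammer_natDegree] at h
  rw [chooseCoeff, h]

theorem chooseCoeff_eq_zero {k l : ℕ} (h : k < l) : chooseCoeff k l = 0 := by
  rw [chooseCoeff, Polynomial.coeff_eq_zero_of_natDegree_lt, zero_div]
  rwa [descPochhammer_natDegree]

theorem choose_eq_sum_chooseCoeff {N k : ℕ} (hk : k ≤ N) (x : ℕ) :
    (x.choose k : ℝ) = ∑ l ∈ Finset.range (N + 1), chooseCoeff k l * (x : ℝ) ^ l := by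
  have h := descPochhammer_eval_eq_descFactorial ℝ x k
  rw [Polynomial.eval_eq_sum_range' (n := N + 1) (by rw [descPochhammer_natDegree]; omega)] at h
  have hk0 : (k.factorial : ℝ) ≠ 0 := by positivity
  rw [Nat.descFactorial_eq_factorial_mul_choose, Nat.cast_mul] at h
  rw [eq_comm, mul_comm] at h
  rw [eq_div_of_mul_eq hk0 h, Finset.sum_div]
  exact Finset.sum_congr rfl fun l _ => by rw [chooseCoeff]; ring

/-- The binomial theorem with each binomial coefficient written in powers of `x`. It separates the
exponent `x` from `t`, so that sums over exponents turn into moments. -/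
theorem one_add_pow_eq_sum {N x : ℕ} (hx : x ≤ N) (t : ℝ) :
    (1 + t) ^ x = ∑ k ∈ Finset.range (N + 1), ∑ l ∈ Finset.range (N + 1),
      chooseCoeff k l * (x : ℝ) ^ l * t ^ k := by
  have h : (1 + t) ^ x = ∑ k ∈ Finset.range (N + 1), (x.choose k : ℝ) * t ^ k := by
    rw [add_comm, add_pow]
    refine (Finset.sum_subset (Finset.range_mono (by omega)) fun k _ hk => ?_).trans
      (Finset.sum_congr rfl fun k _ => by ring)
    rw [Nat.choose_eq_zero_of_lt (by simpa using hk)]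
    simp
  rw [h]
  refine Finset.sum_congr rfl fun k hk => ?_
  rw [choose_eq_sum_chooseCoeff (N := N) (by simpa [Nat.lt_succ_iff] using hk), Finset.sum_mul]

variable {τ : Type} [Fintype τ] [DecidableEq τ]

/-- The functions `τ → ℕ` with values at most `N`. -/
abbrev box (τ : Type) [Fintype τ] [DecidableEq τ] (N : ℕ) : Finset (τ → ℕ) :=
  Fintype.piFinset fun _ => Finset.range (N + 1)

/-- A weight on a box is determined by its moments. -/
theorem eq_zero_of_moments {N : ℕ} (J : Finset (τ → ℕ)) (hJ : J ⊆ box τ N)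
    (a : (τ → ℕ) → ℝ)
    (h : ∀ k ∈ box τ N, ∑ γ ∈ J, a γ * ∏ i, (γ i : ℝ) ^ k i = 0) : ∀ γ ∈ J, a γ = 0 := by
  intro γ₀ hγ₀
  -- The polynomial `P i` vanishes at every integer of the range except `γ₀ i`. Its degree is at
  -- most `N`, so the product over `i` uses only moments from the box.
  set P : τ → Polynomial ℝ := fun i =>
    ∏ j ∈ (Finset.range (N + 1)).erase (γ₀ i), (Polynomial.X - Polynomial.C (j : ℝ)) with hP
  have hmem : ∀ γ ∈ J, ∀ i, γ i ∈ Finset.range (N + 1) := fun γ hγ i =>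
    Fintype.mem_piFinset.1 (hJ hγ) i
  have hdeg : ∀ i, (P i).natDegree < N + 1 := by
    intro i
    rw [hP]
    simp only
    rw [Polynomial.natDegree_prod_of_monic _ _ fun j _ => Polynomial.monic_X_sub_C _]
    simp only [Polynomial.natDegree_X_sub_C, Finset.sum_const, smul_eq_mul, mul_one]
    rw [Finset.card_erase_of_mem (hmem _ hγ₀ i), Finset.card_range]
    omega
  have hsum : ∑ γ ∈ J, a γ * ∏ i, (P i).eval (γ i : ℝ) = 0 := by
    have : ∀ γ : τ → ℕ, ∏ i, (P i).eval (γ i : ℝ) =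
        ∑ k ∈ box τ N, (∏ i, (P i).coeff (k i)) * ∏ i, (γ i : ℝ) ^ k i := by
      intro γ
      simp only [Polynomial.eval_eq_sum_range' (hdeg _)]
      rw [Finset.prod_univ_sum]
      exact Finset.sum_congr rfl fun k _ => Finset.prod_mul_distrib
    simp only [this, Finset.mul_sum]
    rw [Finset.sum_comm]
    refine Finset.sum_eq_zero fun k hk => ?_
    rw [← mul_zero (∏ i, (P i).coeff (k i)), ← h k hk, Finset.mul_sum]
    exact Finset.sum_congr rfl fun γ _ => by ring
  rw [Finset.sum_eq_single_of_mem γ₀ hγ₀] at hsum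
  · refine (mul_eq_zero.1 hsum).resolve_right (Finset.prod_ne_zero_iff.2 fun i _ => ?_)
    rw [hP, Polynomial.eval_prod]
    refine Finset.prod_ne_zero_iff.2 fun j hj => ?_
    rw [Polynomial.eval_sub, Polynomial.eval_X, Polynomial.eval_C, sub_ne_zero]
    exact_mod_cast (Finset.ne_of_mem_erase hj).symm
  · intro γ hγ hne
    obtain ⟨i, hi⟩ := Function.ne_iff.1 hne
    rw [Finset.prod_eq_zero (Finset.mem_univ i), mul_zero]
    rw [hP, Polynomial.eval_prod]
    refine Finset.prod_eq_zero (i := γ i) (Finset.mem_erase.2 ⟨hi, hmem γ hγ i⟩) ?_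
    simp

/-- For a suitable `ε > 0` the kernel `(1 + ε γ') ^ γ` is nondegenerate on `J`. -/
theorem exists_kernel_nondegenerate (J : Finset (τ → ℕ)) :
    ∃ ε : ℝ, 0 < ε ∧ ∀ a : (τ → ℕ) → ℝ,
      (∀ γ' ∈ J, ∑ γ ∈ J, a γ * ∏ i, (1 + ε * (γ' i : ℝ)) ^ γ i = 0) → ∀ γ ∈ J, a γ = 0 := by
  obtain ⟨N, hN⟩ : ∃ N, J ⊆ box τ N := by
    refine ⟨J.sup fun γ => ∑ i, γ i, fun γ hγ => Fintype.mem_piFinset.2 fun i => ?_⟩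
    rw [Finset.mem_range, Nat.lt_succ_iff]
    exact (Finset.single_le_sum (fun _ _ => Nat.zero_le _) (Finset.mem_univ i)).trans
      (Finset.le_sup (f := fun γ : τ → ℕ => ∑ i, γ i) hγ)
  -- The truncated subtraction in the exponent is harmless: `chooseCoeff` kills the entry unless `l
  -- ≤ k`. For `l ≤ k`, `l ≠ k` the exponent is positive, so at `η = 0` only the diagonal survives,
  -- and its entries are products of inverse factorials.
  obtain ⟨η, hη, hdef⟩ := exists_pos_quadratic_definite (box τ N)
    (fun k l η => (∏ i, chooseCoeff (k i) (l i)) * η ^ (∑ i, k i - ∑ i, l i))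
    (fun k l => by fun_prop) (∏ _i : τ, 1 / (N.factorial : ℝ)) (by positivity)
    (fun k hk => by
      simp only [le_refl, tsub_eq_zero_of_le, pow_zero, mul_one, chooseCoeff_self]
      refine Finset.prod_le_prod (fun _ _ => by positivity) fun i _ => ?_
      have : k i ≤ N := by simpa [Nat.lt_succ_iff] using Fintype.mem_piFinset.1 hk i
      exact one_div_le_one_div_of_le (by positivity) (by exact_mod_cast Nat.factorial_le this))
    (fun k hk l hl hne => by
      by_cases hle : l ≤ k
      · have : ∑ i, l i < ∑ i, k i := Finset.sum_lt_sum (fun i _ => hle i) (by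
          obtain ⟨i, hi⟩ := Function.ne_iff.1 hne
          exact ⟨i, Finset.mem_univ i, lt_of_le_of_ne (hle i) (Ne.symm hi)⟩)
        rw [zero_pow (by omega), mul_zero]
      · obtain ⟨i, hi⟩ := not_forall.1 hle
        rw [Finset.prod_eq_zero (Finset.mem_univ i) (chooseCoeff_eq_zero (not_le.1 hi)), zero_mul])
  refine ⟨η ^ 2, by positivity, fun a ha => eq_zero_of_moments J hN a fun k hk => ?_⟩
  set μ : (τ → ℕ) → ℝ := fun k => ∑ γ ∈ J, a γ * ∏ i, (γ i : ℝ) ^ k i with hμ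
  have hexp : ∀ γ ∈ J, ∀ γ' : τ → ℕ, ∏ i, (1 + η ^ 2 * (γ' i : ℝ)) ^ γ i =
      ∑ k ∈ box τ N, ∑ l ∈ box τ N, (∏ i, chooseCoeff (k i) (l i)) * (η ^ 2) ^ (∑ i, k i) *
        (∏ i, (γ i : ℝ) ^ l i) * ∏ i, (γ' i : ℝ) ^ k i := by
    intro γ hγ γ'
    have hx : ∀ i, γ i ≤ N := fun i => by
      simpa [Nat.lt_succ_iff] using Fintype.mem_piFinset.1 (hN hγ) i
    simp only [one_add_pow_eq_sum (hx _)]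
    rw [Finset.prod_univ_sum]
    refine Finset.sum_congr rfl fun k _ => ?_
    rw [Finset.prod_univ_sum]
    refine Finset.sum_congr rfl fun l _ => ?_
    simp only [Finset.prod_mul_distrib, mul_pow, Finset.prod_pow_eq_pow_sum]
    ring
  -- The equations are tested against `a` itself. With ε = η², the power η^(2|k|) splits as
  -- η^(|k|-|l|) · η^|k| · η^|l|, and the last two factors are absorbed into the moments.
  have hquad : ∑ k ∈ box τ N, ∑ l ∈ box τ N, ((∏ i, chooseCoeff (k i) (l i)) *
      η ^ (∑ i, k i - ∑ i, l i)) * (η ^ (∑ i, k i) * μ k) * (η ^ (∑ i, l i) * μ l) = 0 := by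
    have h0 : ∑ γ' ∈ J, a γ' * ∑ γ ∈ J, a γ * ∏ i, (1 + η ^ 2 * (γ' i : ℝ)) ^ γ i = 0 :=
      Finset.sum_eq_zero fun γ' hγ' => by rw [ha γ' hγ', mul_zero]
    rw [← h0]
    have h1 : ∀ k l, ((∏ i, chooseCoeff (k i) (l i)) *
        η ^ (∑ i, k i - ∑ i, l i)) * (η ^ (∑ i, k i) * μ k) * (η ^ (∑ i, l i) * μ l) =
        ∑ γ' ∈ J, ∑ γ ∈ J, a γ' * (a γ * ((∏ i, chooseCoeff (k i) (l i)) * (η ^ 2) ^ (∑ i, k i) *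
        (∏ i, (γ i : ℝ) ^ l i) * ∏ i, (γ' i : ℝ) ^ k i)) := by
      intro k l
      have h2 : (∏ i, chooseCoeff (k i) (l i)) * η ^ (∑ i, k i - ∑ i, l i) * η ^ (∑ i, k i) *
          η ^ (∑ i, l i) = (∏ i, chooseCoeff (k i) (l i)) * (η ^ 2) ^ (∑ i, k i) := by
        by_cases hle : l ≤ k
        · have : ∑ i, l i ≤ ∑ i, k i := Finset.sum_le_sum fun i _ => hle i
          rw [mul_assoc, mul_assoc, ← pow_add, ← pow_add, ← pow_mul]
          congr 2
          omega
        · obtain ⟨i, hi⟩ := not_forall.1 hle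
          rw [Finset.prod_eq_zero (Finset.mem_univ i) (chooseCoeff_eq_zero (not_le.1 hi))]
          simp
      calc _ = ((∏ i, chooseCoeff (k i) (l i)) * η ^ (∑ i, k i - ∑ i, l i) * η ^ (∑ i, k i) *
          η ^ (∑ i, l i)) * (μ k * μ l) := by ring
        _ = _ := by
          rw [h2, hμ]
          simp only
          rw [Finset.sum_mul_sum, Finset.mul_sum]
          refine Finset.sum_congr rfl fun γ' _ => ?_
          rw [Finset.mul_sum]
          exact Finset.sum_congr rfl fun γ _ => by ring
    simp only [h1]
    have h3 : ∀ γ' : τ → ℕ, ∀ γ ∈ J, a γ' * (a γ * ∏ i, (1 + η ^ 2 * (γ' i : ℝ)) ^ γ i) =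
        ∑ k ∈ box τ N, ∑ l ∈ box τ N, a γ' * (a γ * ((∏ i, chooseCoeff (k i) (l i)) *
          (η ^ 2) ^ (∑ i, k i) * (∏ i, (γ i : ℝ) ^ l i) * ∏ i, (γ' i : ℝ) ^ k i)) := by
      intro γ' γ hγ
      rw [hexp γ hγ γ']
      simp only [Finset.mul_sum]
    simp only [Finset.mul_sum]
    rw [Finset.sum_congr rfl fun γ' _ => Finset.sum_congr rfl fun γ hγ => h3 γ' γ hγ]
    rw [Finset.sum_congr rfl fun k _ => Finset.sum_comm, Finset.sum_comm]
    refine Finset.sum_congr rfl fun γ' _ => ?_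
    rw [Finset.sum_congr rfl fun k _ => Finset.sum_comm, Finset.sum_comm]
  have := hdef (fun k => η ^ (∑ i, k i) * μ k) hquad.le k hk
  exact (mul_eq_zero.1 this).resolve_left (by positivity)

end Kernel

/-! ### Unisolvence of interpolation at the nodes -/

section Nodal

variable {τ : Type}

/-- The values at the points `z γ`, `γ ∈ J`, determine the polynomials whose monomials
have their exponents in `J`. -/
def IsUnisolvent (J : Set (τ → ℕ)) (z : (τ → ℕ) → τ → ℝ) : Prop :=
  ∀ q : MvPolynomial τ ℝ, (∀ m ∈ q.support, ⇑m ∈ J) →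
    (∀ γ ∈ J, MvPolynomial.eval (z γ) q = 0) → q = 0

theorem eval_eq_sum_of_support [Fintype τ] {J : Finset (τ → ℕ)} {q : MvPolynomial τ ℝ}
    (hq : ∀ m ∈ q.support, ⇑m ∈ J) (y : τ → ℝ) :
    MvPolynomial.eval y q =
      ∑ γ ∈ J, q.coeff (Finsupp.equivFunOnFinite.symm γ) * ∏ i, y i ^ γ i := by
  classical
  rw [MvPolynomial.eval_eq']
  refine (Finset.sum_subset (s₂ := J.map Finsupp.equivFunOnFinite.symm.toEmbedding)
    (fun m hm => Finset.mem_map.2 ⟨m, hq m hm, by simp⟩) fun m _ hm => ?_).trans ?_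
  · rw [MvPolynomial.notMem_support_iff.1 hm, zero_mul]
  · rw [Finset.sum_map]
    rfl

/-- Passage from polynomials to the kernel of the collocation matrix, where determinants and the
kernel estimate apply. -/
theorem isUnisolvent_iff [Fintype τ] {J : Finset (τ → ℕ)} {z : (τ → ℕ) → τ → ℝ} :
    IsUnisolvent (J : Set (τ → ℕ)) z ↔ ∀ a : (τ → ℕ) → ℝ,
      (∀ γ' ∈ J, ∑ γ ∈ J, a γ * ∏ i, z γ' i ^ γ i = 0) → ∀ γ ∈ J, a γ = 0 := by
  classical
  constructor
  · intro h a ha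
    set q : MvPolynomial τ ℝ :=
      ∑ γ ∈ J, MvPolynomial.monomial (Finsupp.equivFunOnFinite.symm γ) (a γ) with hq
    have hc : ∀ m : τ →₀ ℕ, q.coeff m = if ⇑m ∈ J then a m else 0 := by
      intro m
      rw [hq, MvPolynomial.coeff_sum]
      simp only [MvPolynomial.coeff_monomial, Equiv.symm_apply_eq]
      rw [Finset.sum_ite_eq' J]
      rfl
    have hs : ∀ m ∈ q.support, ⇑m ∈ J := by
      intro m hm
      rw [MvPolynomial.mem_support_iff, hc] at hm
      by_contra hn
      exact hm (if_neg hn)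
    have h0 := h q (fun m hm => Finset.mem_coe.2 (hs m hm)) fun γ' hγ' => by
      rw [eval_eq_sum_of_support hs, ← ha γ' hγ']
      refine Finset.sum_congr rfl fun γ hγ => ?_
      rw [hc, if_pos]
      · rfl
      · exact hγ
    intro γ hγ
    have := hc (Finsupp.equivFunOnFinite.symm γ)
    rw [h0, MvPolynomial.coeff_zero, if_pos (by exact hγ)] at this
    exact this.symm
  · intro h q hs hz
    have h1 := h (fun γ => q.coeff (Finsupp.equivFunOnFinite.symm γ)) fun γ' hγ' => by
      rw [← eval_eq_sum_of_support (fun m hm => Finset.mem_coe.1 (hs m hm))]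
      exact hz γ' hγ'
    ext m
    by_cases hm : m ∈ q.support
    · simpa using h1 m (hs m hm)
    · simpa using hm

theorem IsUnisolvent.of_equiv {σ : Type} (e : τ ≃ σ) {J : Set (τ → ℕ)} {J' : Set (σ → ℕ)}
    (hJ : ∀ γ : σ → ℕ, γ ∈ J' ↔ γ ∘ e ∈ J) {z : (τ → ℕ) → τ → ℝ} {z' : (σ → ℕ) → σ → ℝ}
    (hz : ∀ γ, z' γ ∘ e = z (γ ∘ e)) (h : IsUnisolvent J z) : IsUnisolvent J' z' := by
  intro q hq h0
  refine MvPolynomial.rename_injective _ e.symm.injective ?_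
  rw [map_zero]
  refine h _ (fun m hm => ?_) fun γ hγ => ?_
  · classical
    rw [MvPolynomial.support_rename_of_injective e.symm.injective, Finset.mem_image] at hm
    obtain ⟨m', hm', rfl⟩ := hm
    convert (hJ _).1 (hq m' hm') using 1
    ext i
    simp
  · have := h0 (γ ∘ e.symm) ((hJ _).2 (by simpa [Function.comp_assoc] using hγ))
    rw [MvPolynomial.eval_rename]
    convert this using 3
    have h2 := hz (γ ∘ e.symm)
    simp only [Function.comp_assoc, Equiv.symm_comp_self, Function.comp_id] at h2
    rw [← h2]
    simp [Function.comp_assoc]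

variable [Fintype τ] [DecidableEq τ]

theorem nodeIndex_finite (τ : Type) [Fintype τ] [DecidableEq τ] (s : ℕ) :
    (nodeIndex τ s).Finite := by
  refine (box τ (33 - s)).finite_toSet.subset fun γ hγ => ?_
  rw [Finset.mem_coe, Fintype.mem_piFinset]
  intro i
  rw [Finset.mem_range, Nat.lt_succ_iff, ← hγ.1]
  exact Finset.single_le_sum (fun _ _ => Nat.zero_le _) (Finset.mem_univ i)

theorem mem_nodeIndex_comp_equiv {σ : Type} [Fintype σ] [DecidableEq σ] (e : τ ≃ σ) {s : ℕ}
    (γ : σ → ℕ) : γ ∘ e ∈ nodeIndex τ s ↔ γ ∈ nodeIndex σ s := by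
  have hsum : ∀ G : Finset τ, ∑ i ∈ G, (γ ∘ e) i = ∑ i ∈ G.map e.toEmbedding, γ i := by
    intro G; rw [Finset.sum_map]; rfl
  have hco : ∀ G : Finset τ, (Gᶜ).map e.toEmbedding = (G.map e.toEmbedding)ᶜ := by
    intro G
    ext i
    simp [Finset.mem_map_equiv]
  simp only [nodeIndex, Set.mem_ofPred_eq, hsum, hco, Finset.map_univ_equiv]
  refine and_congr_right fun _ => ⟨fun h G hG hG' => ?_, fun h G hG hG' => ?_⟩
  · have hm : (G.map e.symm.toEmbedding).map e.toEmbedding = G := by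
      ext i; simp [Finset.mem_map_equiv]
    have := h (G.map e.symm.toEmbedding) (hG.map) (fun h => hG' (by rw [← hm, h]; simp))
    rwa [hm, Finset.card_map] at this
  · have := h (G.map e.toEmbedding) hG.map (fun h => hG' (by
      apply Finset.map_injective e.toEmbedding; simp [h]))
    rwa [Finset.card_map] at this

theorem sum_nodeCoord {σ : Type} [Fintype σ] {d s : ℕ} (hσ : Fintype.card σ = d + 1) (h : ℝ)
    {γ : σ → ℕ}
    (hγ : ∑ i, γ i = 33 - s) : ∑ i, nodeCoord d s h γ i = 1 := by
  have hd : (d : ℝ) + 1 ≠ 0 := by positivity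
  simp only [nodeCoord, Finset.sum_add_distrib, Finset.sum_const, Finset.card_univ, hσ,
    ← Finset.mul_sum, Finset.sum_sub_distrib, ← Nat.cast_sum, hγ, nsmul_eq_mul]
  push_cast
  field_simp
  ring

/-- The nodes determine the polynomials spanned by the Bernstein polynomials with index in
`nodeIndex` on a `d`-dimensional simplex. -/
def NodalUnisolvent (d s : ℕ) (h : ℝ) : Prop :=
  IsUnisolvent (nodeIndex (Fin (d + 1)) s) (nodeCoord d s h)

theorem NodalUnisolvent.isUnisolvent {d s : ℕ} {h : ℝ} (H : NodalUnisolvent d s h)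
    (hτ : Fintype.card τ = d + 1) : IsUnisolvent (nodeIndex τ s) (nodeCoord d s h) :=
  IsUnisolvent.of_equiv (Fintype.equivFinOfCardEq hτ).symm
    (fun γ => (mem_nodeIndex_comp_equiv _ γ).symm) (fun _ => rfl) H

/-- The points `1 + ε γ`, scaled to coordinate sum `1`, are lattice nodes. -/
theorem exists_nodalUnisolvent (d s : ℕ) : ∃ h, NodalUnisolvent d s h := by
  set J := (nodeIndex_finite (Fin (d + 1)) s).toFinset with hJ
  obtain ⟨ε, hε, H⟩ := exists_kernel_nondegenerate J
  set n : ℝ := ((33 - s : ℕ) : ℝ) with hn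
  have hn0 : 0 ≤ n := Nat.cast_nonneg _
  -- The reciprocal of the coordinate sum of 1 + εγ' for an index γ' of length `n`.
  set c : ℝ := 1 / (d + 1 + ε * n) with hc
  have hden : (d : ℝ) + 1 + ε * n ≠ 0 := by positivity
  have hc0 : c ≠ 0 := by rw [hc]; positivity
  refine ⟨ε * c, ?_⟩
  rw [NodalUnisolvent, ← Set.Finite.coe_toFinset (nodeIndex_finite (Fin (d + 1)) s), ← hJ,
    isUnisolvent_iff]
  intro a ha
  refine H a fun γ' hγ' => ?_
  have hz : ∀ i, nodeCoord d s (ε * c) γ' i = c * (1 + ε * (γ' i : ℝ)) := by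
    intro i
    have hd : (d : ℝ) + 1 ≠ 0 := by positivity
    rw [nodeCoord, ← hn, hc]
    field_simp
    ring
  -- All exponents have the same total, so rescaling the points multiplies the whole matrix by one
  -- nonzero constant.
  have hpow : ∀ γ ∈ J, ∏ i, nodeCoord d s (ε * c) γ' i ^ γ i =
      c ^ (33 - s) * ∏ i, (1 + ε * (γ' i : ℝ)) ^ γ i := by
    intro γ hγ
    have : ∑ i, γ i = 33 - s := ((Set.Finite.mem_toFinset _).1 hγ).1
    simp only [hz, mul_pow, Finset.prod_mul_distrib, Finset.prod_pow_eq_pow_sum, this]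
  have h0 := ha γ' hγ'
  rw [Finset.sum_congr rfl fun γ hγ => by rw [hpow γ hγ]] at h0
  refine (mul_eq_zero.1 ((?_ : c ^ (33 - s) * _ = _).trans h0)).resolve_left (pow_ne_zero _ hc0)
  rw [Finset.mul_sum]
  exact Finset.sum_congr rfl fun γ _ => by ring

/-- The determinant of the collocation matrix is a polynomial in the spacing. By
`exists_nodalUnisolvent` it is not the zero polynomial, so the bad spacings lie among its finitely
many roots. -/
theorem finite_not_nodalUnisolvent (d s : ℕ) : {h | ¬ NodalUnisolvent d s h}.Finite := by
  set J := (nodeIndex_finite (Fin (d + 1)) s).toFinset with hJ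
  set M : Matrix J J (Polynomial ℝ) := Matrix.of fun γ' γ => ∏ i,
    (Polynomial.C (1 / ((d : ℝ) + 1)) + Polynomial.X *
      Polynomial.C ((γ'.1 i : ℝ) - ((33 - s : ℕ) : ℝ) / ((d : ℝ) + 1))) ^ γ.1 i with hM
  have hiff : ∀ h, NodalUnisolvent d s h ↔ M.det.eval h ≠ 0 := by
    intro h
    have hmap : (M.map (Polynomial.evalRingHom h)) =
        Matrix.of fun γ' γ : J => ∏ i, nodeCoord d s h γ'.1 i ^ γ.1 i := by
      ext γ' γ
      simp only [hM, Matrix.map_apply, Matrix.of_apply, Polynomial.coe_evalRingHom, Polynomial.eval_prod,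
        Polynomial.eval_pow, Polynomial.eval_add, Polynomial.eval_mul, Polynomial.eval_C,
        Polynomial.eval_X, nodeCoord]
    have hdet : M.det.eval h = (M.map (Polynomial.evalRingHom h)).det :=
      RingHom.map_det (Polynomial.evalRingHom h) M
    rw [hdet, hmap, NodalUnisolvent,
      ← Set.Finite.coe_toFinset (nodeIndex_finite (Fin (d + 1)) s), ← hJ, isUnisolvent_iff,
      ne_eq, ← Matrix.exists_mulVec_eq_zero_iff]
    have hsum : ∀ (a : (Fin (d + 1) → ℕ) → ℝ) (γ' : Fin (d + 1) → ℕ),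
        ∑ γ ∈ J, a γ * ∏ i, nodeCoord d s h γ' i ^ γ i =
          ∑ γ : J, (∏ i, nodeCoord d s h γ' i ^ γ.1 i) * a γ := by
      intro a γ'
      rw [← Finset.sum_coe_sort J]
      exact Finset.sum_congr rfl fun γ _ => mul_comm _ _
    constructor
    · rintro H ⟨v, hv, hv0⟩
      refine hv (funext fun γ => ?_)
      have := H (fun γ => if hγ : γ ∈ J then v ⟨γ, hγ⟩ else 0) (fun γ' hγ' => by
        rw [hsum]
        simpa [Matrix.mulVec, dotProduct] using congrFun hv0 ⟨γ', hγ'⟩) γ.1 γ.2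
      simpa using this
    · intro H a ha γ hγ
      by_contra hne
      refine H ⟨fun γ => a γ.1, fun h0 => hne (congrFun h0 ⟨γ, hγ⟩), funext fun γ' => ?_⟩
      exact (hsum a γ').symm.trans (ha γ'.1 γ'.2)
  obtain ⟨h₀, hh₀⟩ := exists_nodalUnisolvent d s
  have hne : M.det ≠ 0 := by
    intro h0
    exact (hiff h₀).1 hh₀ (by rw [h0, Polynomial.eval_zero])
  refine (M.det.roots.toFinset.finite_toSet).subset fun h hh => ?_
  have : M.det.eval h = 0 := by
    by_contra hx
    exact hh ((hiff h).2 hx)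
  simpa [hne] using this

/-- Interpolation at a full principal lattice is unisolvent for every spacing. -/
theorem nodalUnisolvent_of_full {d s a : ℕ} {h : ℝ} (hs : IsInternalSpacing d s h)
    (hJ : ∀ γ : Fin (d + 1) → ℕ, γ ∈ nodeIndex (Fin (d + 1)) s ↔
      ∑ i, γ i = 33 - s ∧ ∀ i, a ≤ γ i) : NodalUnisolvent d s h := by
  classical
  set J := (nodeIndex_finite (Fin (d + 1)) s).toFinset with hJd
  have hmem : ∀ γ, γ ∈ J ↔ ∑ i, γ i = 33 - s ∧ ∀ i, a ≤ γ i := fun γ => by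
    rw [hJd, Set.Finite.mem_toFinset, hJ]
  set z : ℕ → ℝ := fun x =>
    1 / ((d : ℝ) + 1) + h * ((x : ℝ) - ((33 - s : ℕ) : ℝ) / ((d : ℝ) + 1)) with hz
  -- Lagrange products, homogenised with the sum of the variables, which is 1 at every node. The
  -- factors `X i ^ a` keep all exponents at least `a`, hence in `J`.
  set ℓ : (Fin (d + 1) → ℕ) → MvPolynomial (Fin (d + 1)) ℝ := fun γ =>
    ∏ i, (MvPolynomial.X i ^ a * ∏ j ∈ Finset.range (γ i - a),
      (MvPolynomial.X i - MvPolynomial.C (z (a + j)) * ∑ i', MvPolynomial.X i')) with hℓ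
  have hsupp : ∀ γ ∈ J, ∀ m ∈ (ℓ γ).support, ⇑m ∈ J := by
    intro γ hγ m hm
    obtain ⟨hγ1, hγ2⟩ := (hmem γ).1 hγ
    rw [hmem]
    constructor
    · have hom : (ℓ γ).IsHomogeneous (∑ i, γ i) := by
        refine MvPolynomial.IsHomogeneous.prod _ _ _ fun i _ => ?_
        have h1 : (∏ j ∈ Finset.range (γ i - a), (MvPolynomial.X i -
            MvPolynomial.C (z (a + j)) * ∑ i', MvPolynomial.X i') :
            MvPolynomial (Fin (d + 1)) ℝ).IsHomogeneous
              (∑ j ∈ Finset.range (γ i - a), 1) := by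
          refine MvPolynomial.IsHomogeneous.prod _ _ _ fun j _ => ?_
          refine (MvPolynomial.isHomogeneous_X _ _).sub ?_
          exact MvPolynomial.IsHomogeneous.C_mul
            (MvPolynomial.IsHomogeneous.sum _ _ _ fun i _ => MvPolynomial.isHomogeneous_X _ _) _
        have h2 := (MvPolynomial.isHomogeneous_X_pow (R := ℝ) i a).mul h1
        convert h2 using 1
        have := hγ2 i
        simp
        omega
      rw [← hγ1, ← hom (MvPolynomial.mem_support_iff.1 hm), ← Finsupp.degree_eq_sum]
      exact DFunLike.congr_fun Finsupp.degree_eq_weight_one m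
    · intro i
      have hdvd : MvPolynomial.monomial (Finsupp.single i a) (1 : ℝ) ∣ ℓ γ := by
        rw [← MvPolynomial.X_pow_eq_monomial]
        exact (Dvd.intro _ rfl).trans (Finset.dvd_prod_of_mem _ (Finset.mem_univ i))
      obtain ⟨r, hr⟩ := hdvd
      rw [MvPolynomial.mem_support_iff, hr, MvPolynomial.coeff_monomial_mul'] at hm
      have : Finsupp.single i a ≤ m := by
        by_contra hn
        exact hm (if_neg hn)
      simpa using this i
  have heval : ∀ γ γ', γ' ∈ J → MvPolynomial.eval (nodeCoord d s h γ') (ℓ γ) =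
      ∏ i, (z (γ' i) ^ a * ∏ j ∈ Finset.range (γ i - a), (h * ((γ' i : ℝ) - (a + j : ℕ)))) := by
    intro γ γ' hγ'
    have h1 : ∑ i, nodeCoord d s h γ' i = 1 :=
      sum_nodeCoord (by simp) h ((hmem γ').1 hγ').1
    simp only [hℓ, map_prod, map_mul, map_pow, map_sub, map_sum, MvPolynomial.eval_X,
      MvPolynomial.eval_C, h1, mul_one]
    refine Finset.prod_congr rfl fun i _ => ?_
    congr 1
    refine Finset.prod_congr rfl fun j _ => ?_
    simp only [nodeCoord, hz]
    ring
  have hzpos : ∀ γ ∈ J, ∀ i, 0 < z (γ i) := fun γ hγ i =>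
    hs.2 γ ((Set.Finite.mem_toFinset _).1 hγ) i
  have hself : ∀ γ ∈ J, MvPolynomial.eval (nodeCoord d s h γ) (ℓ γ) ≠ 0 := by
    intro γ hγ
    rw [heval γ γ hγ]
    refine Finset.prod_ne_zero_iff.2 fun i _ => mul_ne_zero (pow_ne_zero _ (hzpos γ hγ i).ne')
      (Finset.prod_ne_zero_iff.2 fun j hj => mul_ne_zero hs.1.ne' ?_)
    rw [sub_ne_zero]
    have := Finset.mem_range.1 hj
    exact_mod_cast (by omega : γ i ≠ a + j)
  have hother : ∀ γ ∈ J, ∀ γ' ∈ J, γ ≠ γ' → MvPolynomial.eval (nodeCoord d s h γ') (ℓ γ) = 0 := by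
    intro γ hγ γ' hγ' hne
    -- Two different indices with equal sums: some entry of `γ'` is smaller, and the factor for that
    -- value vanishes at the node of `γ'`.
    obtain ⟨i, hi⟩ : ∃ i, γ' i < γ i := by
      by_contra! hle
      have h1 := ((hmem γ).1 hγ).1
      have h2 := ((hmem γ').1 hγ').1
      have := (Finset.sum_eq_sum_iff_of_le fun i _ => hle i).1 (h1.trans h2.symm)
      exact hne (funext fun i => this i (Finset.mem_univ i))
    rw [heval γ γ' hγ']
    have ha := ((hmem γ').1 hγ').2 i
    refine Finset.prod_eq_zero (Finset.mem_univ i) (mul_eq_zero_of_right _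
      (Finset.prod_eq_zero (i := γ' i - a) (Finset.mem_range.2 (by omega)) ?_))
    rw [show a + (γ' i - a) = γ' i by omega, sub_self, mul_zero]
  rw [NodalUnisolvent, ← Set.Finite.coe_toFinset (nodeIndex_finite (Fin (d + 1)) s), ← hJd,
    isUnisolvent_iff]
  -- The Lagrange products make this square map surjective, and therefore injective.
  set T : (J → ℝ) →ₗ[ℝ] (J → ℝ) := Matrix.toLin'
    (Matrix.of fun γ' γ : J => ∏ i, nodeCoord d s h γ'.1 i ^ γ.1 i) with hT
  have hTapp : ∀ v γ', T v γ' = ∑ γ : J, (∏ i, nodeCoord d s h γ'.1 i ^ γ.1 i) * v γ := by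
    intro v γ'
    rw [hT, Matrix.toLin'_apply]
    rfl
  have hsurj : Function.Surjective T := by
    rw [← LinearMap.range_eq_top, eq_top_iff, ← (Pi.basisFun ℝ J).span_eq, Submodule.span_le]
    rintro _ ⟨γ, rfl⟩
    refine ⟨fun γ' => (ℓ γ).coeff (Finsupp.equivFunOnFinite.symm γ'.1) *
      (MvPolynomial.eval (nodeCoord d s h γ.1) (ℓ γ))⁻¹, funext fun γ' => ?_⟩
    have h1 := eval_eq_sum_of_support (hsupp γ γ.2) (nodeCoord d s h γ'.1)
    rw [← Finset.sum_coe_sort J] at h1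
    have h2 : T (fun γ' => (ℓ γ).coeff (Finsupp.equivFunOnFinite.symm γ'.1) *
      (MvPolynomial.eval (nodeCoord d s h γ.1) (ℓ γ))⁻¹) γ' =
        MvPolynomial.eval (nodeCoord d s h γ'.1) (ℓ γ) *
          (MvPolynomial.eval (nodeCoord d s h γ.1) (ℓ γ))⁻¹ := by
      rw [hTapp, h1, Finset.sum_mul]
      exact Finset.sum_congr rfl fun _ _ => by ring
    rw [h2, Pi.basisFun_apply, Pi.single_apply]
    split_ifs with he
    · rw [he, mul_inv_cancel₀ (hself γ γ.2)]
    · rw [hother γ γ.2 γ' γ'.2 fun h => he (Subtype.ext h.symm), zero_mul]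
  have hinj := LinearMap.injective_iff_surjective.2 hsurj
  intro b hb γ hγ
  have h0 : T (fun γ => b γ.1) = 0 := by
    funext γ'
    rw [hTapp, Pi.zero_apply, ← hb γ'.1 γ'.2, ← Finset.sum_coe_sort J]
    exact Finset.sum_congr rfl fun _ _ => mul_comm _ _
  exact congrFun (hinj (h0.trans (map_zero T).symm)) ⟨γ, hγ⟩

end Nodal

/-! ### Counting by digits, and explicit descriptions of the index sets -/

/-- The number of `γ : Fin k → ℕ` with values in `[a, b]`, `∑ γ = n` and `∑ w (γ i) ≤ W`, read off
from the digits of the generating function at `2 ^ 32`. -/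
def digitCount (a b : ℕ) (w : ℕ → ℕ) (k n W : ℕ) : ℕ :=
  ∑ v ∈ Finset.range (W + 1),
    (∑ g ∈ Finset.Icc a b, (2 ^ 32) ^ (g + 128 * w g)) ^ k / (2 ^ 32) ^ (n + 128 * v) % 2 ^ 32

/-- Each digit in base `B` counts the elements with that exponent. Having fewer than `B` elements in
all, there are no carries. -/
theorem sum_pow_div_mod {α : Type*} (S : Finset α) (T : α → ℕ) {B : ℕ} (hB : S.card < B) (j : ℕ) :
    (∑ x ∈ S, B ^ T x) / B ^ j % B = (S.filter fun x => T x = j).card := by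
  have hB0 : 0 < B := by omega
  set lo := ∑ x ∈ S.filter (fun x => T x < j), B ^ T x with hlo
  set hi := ∑ x ∈ S.filter (fun x => j < T x), B ^ (T x - (j + 1)) with hhi
  set c := (S.filter fun x => T x = j).card with hc
  have hsplit : ∑ x ∈ S, B ^ T x = lo + B ^ j * (c + B * hi) := by
    rw [hlo, hhi, hc, Finset.card_eq_sum_ones, Finset.sum_filter, Finset.sum_filter,
      Finset.sum_filter, Finset.mul_sum, ← Finset.sum_add_distrib, Finset.mul_sum,
      ← Finset.sum_add_distrib]
    refine Finset.sum_congr rfl fun x _ => ?_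
    rcases lt_trichotomy (T x) j with h | h | h
    · simp [h, h.ne, not_lt.2 h.le]
    · simp [h]
    · have h1 : ¬ T x < j := by omega
      have h2 : T x ≠ j := by omega
      rw [if_neg h1, if_neg h2, if_pos h, zero_add, zero_add, ← mul_assoc, ← pow_succ, ← pow_add]
      congr 1
      omega
  have hlo_lt : lo < B ^ j := by
    have h1 : lo * B ≤ S.card * B ^ j := by
      rw [hlo, Finset.sum_mul]
      refine (Finset.sum_le_card_nsmul _ _ (B ^ j) fun x hx => ?_).trans ?_
      · rw [← pow_succ]
        exact Nat.pow_le_pow_right hB0 (Finset.mem_filter.1 hx).2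
      · exact Nat.mul_le_mul_right _ (Finset.card_filter_le _ _)
    have h2 : S.card * B ^ j < B * B ^ j := Nat.mul_lt_mul_of_pos_right hB (by positivity)
    nlinarith
  have hc_lt : c < B := (Finset.card_filter_le _ _).trans_lt hB
  rw [hsplit, Nat.add_mul_div_left _ _ (by positivity), Nat.div_eq_of_lt hlo_lt, zero_add,
    Nat.add_mul_mod_self_left, Nat.mod_eq_of_lt hc_lt]

/-- The exponent 128 · (total weight) + (total of the entries) encodes both totals without overlap,
since `n` and all totals of entries are below 128. The bound on the number of tuples excludes
carries. -/
theorem ncard_eq_digitCount {a b : ℕ} (w : ℕ → ℕ) {k n W : ℕ} (hn : n < 128) (hb : k * b < 128)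
    (hcard : (b + 1 - a) ^ k < 2 ^ 32) :
    {γ : Fin k → ℕ | ∑ i, γ i = n ∧ (∀ i, a ≤ γ i ∧ γ i ≤ b) ∧ ∑ i, w (γ i) ≤ W}.ncard =
      digitCount a b w k n W := by
  classical
  set S : Finset (Fin k → ℕ) := Fintype.piFinset fun _ => Finset.Icc a b with hS
  set T : (Fin k → ℕ) → ℕ := fun γ => ∑ i, (γ i + 128 * w (γ i)) with hT
  have hpow : (∑ g ∈ Finset.Icc a b, (2 ^ 32) ^ (g + 128 * w g)) ^ k =
      ∑ γ ∈ S, (2 ^ 32) ^ T γ := by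
    have := Finset.prod_univ_sum (fun _ : Fin k => Finset.Icc a b)
      (fun _ g => (2 ^ 32) ^ (g + 128 * w g))
    rw [Finset.prod_const, Finset.card_univ, Fintype.card_fin] at this
    rw [this]
    exact Finset.sum_congr rfl fun γ _ => Finset.prod_pow_eq_pow_sum _ _ _
  have hSc : S.card < 2 ^ 32 := by
    rw [hS, Fintype.card_piFinset, Finset.prod_const, Finset.card_univ, Fintype.card_fin,
      Nat.card_Icc]
    exact hcard
  have hmem : ∀ γ, γ ∈ S ↔ ∀ i, a ≤ γ i ∧ γ i ≤ b := by
    intro γ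
    simp [hS, Fintype.mem_piFinset]
  have hdigit : digitCount a b w k n W =
      ∑ v ∈ Finset.range (W + 1), (S.filter fun γ => T γ = n + 128 * v).card := by
    rw [digitCount, hpow]
    exact Finset.sum_congr rfl fun v _ => sum_pow_div_mod S T hSc _
  have hTe : ∀ γ, T γ = ∑ i, γ i + 128 * ∑ i, w (γ i) := fun γ => by
    rw [hT, Finset.mul_sum, ← Finset.sum_add_distrib]
  rw [hdigit, ← Finset.card_biUnion, ← Set.ncard_coe_finset]
  · congr 1
    ext γ
    simp only [Set.mem_ofPred_eq, Finset.coe_biUnion, Finset.coe_range, Set.mem_Iio,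
      Finset.coe_filter, Set.mem_iUnion, hmem, hTe]
    constructor
    · rintro ⟨h1, h2, h3⟩
      exact ⟨_, Nat.lt_succ_of_le h3, h2, by rw [h1]⟩
    · rintro ⟨v, hv, h2, h3⟩
      have : ∑ i, γ i ≤ k * b := by
        simpa using Finset.sum_le_card_nsmul Finset.univ γ b fun i _ => (h2 i).2
      exact ⟨by omega, h2, by omega⟩
  · intro v _ v' _ hne
    rw [Function.onFun, Finset.disjoint_left]
    intro γ h1 h2
    have e1 := (Finset.mem_filter.1 h1).2
    have e2 := (Finset.mem_filter.1 h2).2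
    omega

/-- The condition defining `nodeIndex`, for the subsets `G` of a set of `m` vertices of which `k`
are undecided; `c` is the number of the other elements of `G` and `t` the sum of the other entries
off `G`. -/
def FaceCondition (s m c t : ℕ) {k : ℕ} (γ : Fin k → ℕ) : Prop :=
  ∀ G : Finset (Fin k), c + G.card ≠ 0 → c + G.card ≠ m →
    smoothness (c + G.card - 1) < s + (t + ∑ i ∈ Gᶜ, γ i)

theorem faceCondition_empty {s m c t : ℕ} : FaceCondition s m c t ![] ↔
    (c ≠ 0 → c ≠ m → smoothness (c - 1) < s + t) := by
  refine ⟨fun h => by simpa using h ∅, fun h G => ?_⟩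
  simpa [Finset.eq_empty_of_isEmpty] using h

/-- The first vertex either joins `G` and raises `c`, or stays off `G` and adds its entry to `t`.
Iteration expands the condition over all subsets into finitely many linear inequalities. -/
theorem faceCondition_cons {s m c t k : ℕ} (a : ℕ) (γ : Fin k → ℕ) :
    FaceCondition s m c t (Matrix.vecCons a γ) ↔
      FaceCondition s m (c + 1) t γ ∧ FaceCondition s m c (t + a) γ := by
  have h1 : ∀ G : Finset (Fin k), (insert 0 (G.map (Fin.succEmb k)))ᶜ = Gᶜ.map (Fin.succEmb k) := by
    intro G
    ext i
    refine Fin.cases ?_ (fun j => ?_) i <;> simp [Fin.succ_ne_zero]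
  have h2 : ∀ G : Finset (Fin k), (G.map (Fin.succEmb k))ᶜ = insert 0 (Gᶜ.map (Fin.succEmb k)) := by
    intro G
    rw [← compl_inj_iff, compl_compl, h1, compl_compl]
  have h3 : ∀ G : Finset (Fin k), (0 : Fin (k + 1)) ∉ G.map (Fin.succEmb k) := by
    intro G
    simp [Fin.succ_ne_zero]
  have e1 : ∀ G : Finset (Fin k), c + (insert 0 (G.map (Fin.succEmb k))).card = c + 1 + G.card := by
    intro G
    rw [Finset.card_insert_of_notMem (h3 G), Finset.card_map]
    ring
  have e2 : ∀ G : Finset (Fin k), t + ∑ i ∈ (G.map (Fin.succEmb k))ᶜ, Matrix.vecCons a γ i =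
      t + a + ∑ i ∈ Gᶜ, γ i := by
    intro G
    rw [h2, Finset.sum_insert (h3 _), Finset.sum_map, add_assoc]
    rfl
  have e3 : ∀ G : Finset (Fin k), ∑ i ∈ (insert 0 (G.map (Fin.succEmb k)))ᶜ, Matrix.vecCons a γ i =
      ∑ i ∈ Gᶜ, γ i := by
    intro G
    rw [h1, Finset.sum_map]
    rfl
  constructor
  · intro h
    refine ⟨fun G => ?_, fun G => ?_⟩
    · have := h (insert 0 (G.map (Fin.succEmb k)))
      rwa [e1, e3] at this
    · have := h (G.map (Fin.succEmb k))
      rwa [e2, Finset.card_map] at this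
  · rintro ⟨ha, hb⟩ G
    set G' : Finset (Fin k) := Finset.univ.filter fun i => i.succ ∈ G with hG'
    by_cases h0 : 0 ∈ G
    · have hG : G = insert 0 (G'.map (Fin.succEmb k)) := by
        ext i
        refine Fin.cases ?_ (fun j => ?_) i <;> simp [hG', h0, Fin.succ_ne_zero]
      rw [hG, e1, e3]
      exact ha G'
    · have hG : G = G'.map (Fin.succEmb k) := by
        ext i
        refine Fin.cases ?_ (fun j => ?_) i <;> simp [hG', h0, Fin.succ_ne_zero]
      rw [hG, e2, Finset.card_map]
      exact hb G'

theorem mem_nodeIndex_fin {k s : ℕ} (γ : Fin k → ℕ) : γ ∈ nodeIndex (Fin k) s ↔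
    ∑ i, γ i = 33 - s ∧ FaceCondition s k 0 0 γ := by
  have : ∀ G : Finset (Fin k), G ≠ Finset.univ ↔ G.card ≠ k := fun G => by
    rw [ne_eq, ← Finset.card_eq_iff_eq_univ, Fintype.card_fin]
  simp only [nodeIndex, Set.mem_ofPred_eq, ← Finset.card_ne_zero, this, FaceCondition, zero_add]

theorem mem_nodeIndex_two {s : ℕ} (γ : Fin 2 → ℕ) : γ ∈ nodeIndex (Fin 2) s ↔
    ∑ i, γ i = 33 - s ∧ ∀ i, 17 - s ≤ γ i := by
  obtain ⟨a, b, rfl⟩ : ∃ a b, γ = ![a, b] := ⟨γ 0, γ 1, by ext i; fin_cases i <;> rfl⟩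
  rw [mem_nodeIndex_fin]
  simp only [faceCondition_cons, faceCondition_empty, Fin.sum_univ_succ, Fin.sum_univ_zero,
    Fin.forall_fin_succ, IsEmpty.forall_iff, Matrix.cons_val_zero, Matrix.cons_val_succ]
  norm_num [smoothness]
  omega

/-- Edges give the lower bound. Vertices bound the sum of the other two entries from below, which
becomes the upper bound 16 because the total is fixed. -/
theorem mem_nodeIndex_three {s : ℕ} (hs : s ≤ 4) (γ : Fin 3 → ℕ) : γ ∈ nodeIndex (Fin 3) s ↔
    ∑ i, γ i = 33 - s ∧ ∀ i, 9 - s ≤ γ i ∧ γ i ≤ 16 := by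
  obtain ⟨a, b, c, rfl⟩ : ∃ a b c, γ = ![a, b, c] :=
    ⟨γ 0, γ 1, γ 2, by ext i; fin_cases i <;> rfl⟩
  rw [mem_nodeIndex_fin]
  simp only [faceCondition_cons, faceCondition_empty, Fin.sum_univ_succ, Fin.sum_univ_zero,
    Fin.forall_fin_succ, IsEmpty.forall_iff, Matrix.cons_val_zero, Matrix.cons_val_succ]
  norm_num [smoothness]
  omega

/-- The edge condition bounds sums of two entries by 9 - s from below. It follows from the bound on
single entries when s ≤ 1; for s = 2 it says that at most one entry equals 3. The factor `s - 1`
switches the weight on only then. -/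
theorem mem_nodeIndex_four {s : ℕ} (hs : s ≤ 2) (γ : Fin 4 → ℕ) : γ ∈ nodeIndex (Fin 4) s ↔
    ∑ i, γ i = 33 - s ∧ (∀ i, 5 - s ≤ γ i ∧ γ i ≤ 16) ∧ ∑ i, (s - 1) * (4 - γ i) ≤ 1 := by
  obtain ⟨a, b, c, d, rfl⟩ : ∃ a b c d, γ = ![a, b, c, d] :=
    ⟨γ 0, γ 1, γ 2, γ 3, by ext i; fin_cases i <;> rfl⟩
  rw [mem_nodeIndex_fin]
  simp only [faceCondition_cons, faceCondition_empty, Fin.sum_univ_succ, Fin.sum_univ_zero,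
    Fin.forall_fin_succ, IsEmpty.forall_iff, Matrix.cons_val_zero, Matrix.cons_val_succ]
  interval_cases s <;> norm_num [smoothness] <;> omega

theorem mem_nodeIndex_five_zero (γ : Fin 5 → ℕ) : γ ∈ nodeIndex (Fin 5) 0 ↔
    ∑ i, γ i = 33 ∧ ∀ i, 3 ≤ γ i ∧ γ i ≤ 16 := by
  obtain ⟨a, b, c, d, e, rfl⟩ : ∃ a b c d e, γ = ![a, b, c, d, e] :=
    ⟨γ 0, γ 1, γ 2, γ 3, γ 4, by ext i; fin_cases i <;> rfl⟩
  rw [mem_nodeIndex_fin]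
  simp only [faceCondition_cons, faceCondition_empty, Fin.sum_univ_succ, Fin.sum_univ_zero,
    Fin.forall_fin_succ, IsEmpty.forall_iff, Matrix.cons_val_zero, Matrix.cons_val_succ]
  norm_num [smoothness]
  omega

/-- Beyond the bounds on single entries, the edge condition says that any three entries sum to at
least 8, which excludes the triples 2,2,2 and 2,2,3. Weight 5 for an entry 2 and weight 1 for an
entry 3, with total at most 10, excludes exactly these. -/
theorem mem_nodeIndex_five_one (γ : Fin 5 → ℕ) : γ ∈ nodeIndex (Fin 5) 1 ↔
    ∑ i, γ i = 32 ∧ (∀ i, 2 ≤ γ i ∧ γ i ≤ 16) ∧ ∑ i, ((4 - γ i) + 3 * (3 - γ i)) ≤ 10 := by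
  obtain ⟨a, b, c, d, e, rfl⟩ : ∃ a b c d e, γ = ![a, b, c, d, e] :=
    ⟨γ 0, γ 1, γ 2, γ 3, γ 4, by ext i; fin_cases i <;> rfl⟩
  rw [mem_nodeIndex_fin]
  simp only [faceCondition_cons, faceCondition_empty, Fin.sum_univ_succ, Fin.sum_univ_zero,
    Fin.forall_fin_succ, IsEmpty.forall_iff, Matrix.cons_val_zero, Matrix.cons_val_succ]
  norm_num [smoothness]
  intro hsum
  constructor
  · rintro h
    refine ⟨by omega, ?_⟩
    omega
  · rintro h
    omega

/-- The edge condition, four entries summing to at least 9, says that at most three entries equal 2.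
The weight counts these entries. -/
theorem mem_nodeIndex_six (γ : Fin 6 → ℕ) : γ ∈ nodeIndex (Fin 6) 0 ↔
    ∑ i, γ i = 33 ∧ (∀ i, 2 ≤ γ i ∧ γ i ≤ 16) ∧ ∑ i, (3 - γ i) ≤ 3 := by
  obtain ⟨a, b, c, d, e, f, rfl⟩ : ∃ a b c d e f, γ = ![a, b, c, d, e, f] :=
    ⟨γ 0, γ 1, γ 2, γ 3, γ 4, γ 5, by ext i; fin_cases i <;> rfl⟩
  rw [mem_nodeIndex_fin]
  simp only [faceCondition_cons, faceCondition_empty, Fin.sum_univ_succ, Fin.sum_univ_zero,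
    Fin.forall_fin_succ, IsEmpty.forall_iff, Matrix.cons_val_zero, Matrix.cons_val_succ]
  norm_num [smoothness]
  intro hsum
  constructor
  · rintro h
    refine ⟨by omega, ?_⟩
    omega
  · rintro h
    omega

/-! ### Numbers of degrees of freedom and the dimension of `P33` -/

section Count

theorem ncard_nodeIndex_one (s : ℕ) : (nodeIndex (Fin 1) s).ncard = 1 := by
  rw [Set.ncard_eq_one]
  refine ⟨![33 - s], ?_⟩
  ext γ
  obtain ⟨a, rfl⟩ : ∃ a, γ = ![a] := ⟨γ 0, by ext i; fin_cases i; rfl⟩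
  rw [mem_nodeIndex_fin, Set.mem_singleton_iff]
  simp only [faceCondition_cons, faceCondition_empty]
  simp [Matrix.vecCons_inj]

theorem ncard_eq_digitCount_of_forall_mem {a b : ℕ} (w : ℕ → ℕ) {k n W : ℕ} (hn : n < 128)
    (hb : k * b < 128) (hcard : (b + 1 - a) ^ k < 2 ^ 32) {S : Set (Fin k → ℕ)}
    (hS : ∀ γ, γ ∈ S ↔ ∑ i, γ i = n ∧ (∀ i, a ≤ γ i ∧ γ i ≤ b) ∧ ∑ i, w (γ i) ≤ W) :
    S.ncard = digitCount a b w k n W := by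
  rw [← ncard_eq_digitCount w hn hb hcard]
  congr 1
  ext γ
  exact hS γ

theorem ncard_nodeIndex_two {s : ℕ} (hs : s ≤ 8) : (nodeIndex (Fin 2) s).ncard = s := by
  rw [ncard_eq_digitCount_of_forall_mem (a := 17 - s) (b := 33) (W := 0) (fun _ => 0)
    (show 33 - s < 128 by omega) (by norm_num)
    ((Nat.pow_le_pow_left (show 33 + 1 - (17 - s) ≤ 34 by omega) 2).trans_lt (by norm_num))
    fun γ => ?_]
  · interval_cases s <;> decide +kernel
  · rw [mem_nodeIndex_two]
    simp only [Fin.sum_univ_two, Fin.forall_fin_two]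
    omega

theorem ncard_nodeIndex_three {s : ℕ} (hs : s ≤ 4) :
    (nodeIndex (Fin 3) s).ncard = digitCount (9 - s) 16 (fun _ => 0) 3 (33 - s) 0 :=
  ncard_eq_digitCount_of_forall_mem _ (by omega) (by norm_num)
    ((Nat.pow_le_pow_left (show 16 + 1 - (9 - s) ≤ 17 by omega) 3).trans_lt (by norm_num))
    fun γ => by rw [mem_nodeIndex_three hs]; simp

theorem ncard_nodeIndex_four {s : ℕ} (hs : s ≤ 2) :
    (nodeIndex (Fin 4) s).ncard =
      digitCount (5 - s) 16 (fun g => (s - 1) * (4 - g)) 4 (33 - s) 1 :=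
  ncard_eq_digitCount_of_forall_mem _ (by omega) (by norm_num)
    ((Nat.pow_le_pow_left (show 16 + 1 - (5 - s) ≤ 17 by omega) 4).trans_lt (by norm_num))
    fun γ => mem_nodeIndex_four hs γ

theorem ncard_nodeIndex_five_zero : (nodeIndex (Fin 5) 0).ncard = 6965 := by
  rw [ncard_eq_digitCount_of_forall_mem (a := 3) (b := 16) (n := 33) (W := 0) (fun _ => 0)
    (by norm_num) (by norm_num) (by norm_num) fun γ => by rw [mem_nodeIndex_five_zero]; simp]
  decide +kernel

theorem ncard_nodeIndex_five_one : (nodeIndex (Fin 5) 1).ncard = 12990 := by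
  rw [ncard_eq_digitCount_of_forall_mem (a := 2) (b := 16) (n := 32) (W := 10)
    (fun g => (4 - g) + 3 * (3 - g)) (by norm_num) (by norm_num) (by norm_num)
    mem_nodeIndex_five_one]
  decide +kernel

theorem ncard_nodeIndex_six : (nodeIndex (Fin 6) 0).ncard = 62888 := by
  rw [ncard_eq_digitCount_of_forall_mem (a := 2) (b := 16) (n := 33) (W := 3)
    (fun g => 3 - g) (by norm_num) (by norm_num) (by norm_num) mem_nodeIndex_six]
  decide +kernel

theorem ncard_nodeIndex_eq {τ : Type} [Fintype τ] [DecidableEq τ] (s : ℕ) :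
    (nodeIndex τ s).ncard = (nodeIndex (Fin (Fintype.card τ)) s).ncard := by
  have e := Fintype.equivFin τ
  refine Set.ncard_congr (fun γ _ => γ ∘ e.symm) (fun γ hγ => ?_) (fun γ γ' _ _ h => ?_)
    fun γ hγ => ⟨γ ∘ e, (mem_nodeIndex_comp_equiv e γ).2 hγ, by simp [Function.comp_assoc]⟩
  · exact (mem_nodeIndex_comp_equiv e.symm γ).2 hγ
  · exact e.symm.surjective.injective_comp_right h

instance finite_sum_le (m r : ℕ) : Finite {β : Fin m → ℕ // ∑ j, β j ≤ r} := by
  refine ((box (Fin m) r).finite_toSet.subset fun β hβ => ?_).to_subtype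
  rw [Finset.mem_coe, Fintype.mem_piFinset]
  exact fun i => Finset.mem_range.2 (Nat.lt_succ_of_le
    ((Finset.single_le_sum (fun _ _ => Nat.zero_le _) (Finset.mem_univ i)).trans hβ))

instance finite_nodeIndex {τ : Type} [Fintype τ] [DecidableEq τ] (s : ℕ) :
    Finite (nodeIndex τ s) := (nodeIndex_finite τ s).to_subtype

/-- The number of degrees of freedom on a face with `c` vertices. -/
noncomputable def faceCount (c : ℕ) : ℕ :=
  Nat.card (Σ β : {β : Fin (6 - c) → ℕ // ∑ j, β j ≤ smoothness (c - 1)},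
    nodeIndex (Fin c) (∑ j, β.1 j))

theorem card_piAntidiag_univ (m s : ℕ) :
    (Finset.piAntidiag (Finset.univ : Finset (Fin m)) s).card = (m + s - 1).choose s := by
  have h := Finset.card_finsuppAntidiag_nat_eq_choose (s := (Finset.univ : Finset (Fin m))) s
  rw [Finset.card_univ, Fintype.card_fin] at h
  rw [← h]
  refine Finset.card_bij' (fun β _ => Finsupp.equivFunOnFinite.symm β) (fun β _ => ⇑β) ?_ ?_ ?_ ?_
  · intro β hβ
    simpa [Finset.mem_finsuppAntidiag] using hβ
  · intro β hβ
    simpa [Finset.mem_finsuppAntidiag] using hβ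
  · intro β _; rfl
  · intro β _; ext i; rfl

/-- The number of nodes depends on a normal multi-index only through its order, and the
multi-indices of order `s` in `6 - c` variables are counted by stars and bars. -/
theorem faceCount_eq {c : ℕ} {f : ℕ → ℕ}
    (hf : ∀ s ≤ smoothness (c - 1), (nodeIndex (Fin c) s).ncard = f s) :
    faceCount c = ∑ s ∈ Finset.range (smoothness (c - 1) + 1), (6 - c + s - 1).choose s * f s := by
  classical
  have := Fintype.ofFinite {β : Fin (6 - c) → ℕ // ∑ j, β j ≤ smoothness (c - 1)}
  rw [faceCount, Nat.card_sigma,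
    ← Finset.sum_subtype ((Finset.range (smoothness (c - 1) + 1)).biUnion fun s =>
      Finset.piAntidiag (Finset.univ : Finset (Fin (6 - c))) s) (p := fun β => ∑ j, β j ≤
        smoothness (c - 1)) (fun β => by simp)
      (fun β => Nat.card (nodeIndex (Fin c) (∑ j, β j))), Finset.sum_biUnion]
  · refine Finset.sum_congr rfl fun s hs => ?_
    rw [← card_piAntidiag_univ, ← smul_eq_mul, ← Finset.sum_const]
    refine Finset.sum_congr rfl fun β hβ => ?_
    have h : ∑ j, β j = s := by simpa using hβ
    rw [h]
    exact hf s (Nat.lt_succ_iff.1 (Finset.mem_range.1 hs))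
  · intro s _ s' _ hne
    rw [Function.onFun, Finset.disjoint_left]
    intro β h1 h2
    simp only [Finset.mem_piAntidiag] at h1 h2
    exact hne (h1.1.symm.trans h2.1)

theorem faceCount_one : faceCount 1 = 20349 := by
  rw [faceCount_eq fun s _ => ncard_nodeIndex_one s]
  decide +kernel

theorem faceCount_two : faceCount 2 = 3168 := by
  rw [faceCount_eq (f := id) fun s hs => ncard_nodeIndex_two hs]
  decide +kernel

theorem faceCount_three : faceCount 3 = 2891 := by
  rw [faceCount_eq fun s hs => ncard_nodeIndex_three hs]
  decide +kernel

theorem faceCount_four : faceCount 4 = 6126 := by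
  rw [faceCount_eq fun s hs => ncard_nodeIndex_four hs]
  decide +kernel

theorem faceCount_five : faceCount 5 = 19955 := by
  -- A linear function through the two counts 6965 and 12990.
  rw [faceCount_eq (f := fun s => 6965 + 6025 * s) fun s hs => ?_]
  · decide +kernel
  · change s ≤ 1 at hs
    interval_cases s
    · exact ncard_nodeIndex_five_zero
    · exact ncard_nodeIndex_five_one

theorem faceCount_six : faceCount 6 = 62888 := by
  rw [faceCount_eq (f := fun s => 62888) fun s hs => ?_]
  · decide +kernel
  · change s ≤ 0 at hs
    interval_cases s
    exact ncard_nodeIndex_six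

variable {V : ℕ} {cells : Finset (Finset (Fin V))}

/-- The degrees of freedom on a family of faces, sorted by face and normal derivative. -/
def dofEquiv (S : Finset (Finset (Fin V))) (hS : ∀ F ∈ S, IsFace cells F) :
    {δ : Dof cells // δ.face ∈ S} ≃
      Σ F : S, Σ β : {β : Fin (6 - F.1.card) → ℕ // ∑ j, β j ≤ smoothness (F.1.card - 1)},
        nodeIndex F.1 (∑ j, β.1 j) where
  toFun δ := ⟨⟨δ.1.face, δ.2⟩, ⟨δ.1.normal, δ.1.order_le⟩, ⟨δ.1.node, δ.1.node_mem⟩⟩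
  invFun x := ⟨⟨x.1.1, hS _ x.1.2, x.2.1.1, x.2.1.2, x.2.2.1, x.2.2.2⟩, x.1.2⟩
  left_inv _ := rfl
  right_inv _ := rfl

theorem card_dof_face_mem (S : Finset (Finset (Fin V))) (hS : ∀ F ∈ S, IsFace cells F) :
    Nat.card {δ : Dof cells // δ.face ∈ S} = ∑ F ∈ S, faceCount F.card := by
  rw [Nat.card_congr (dofEquiv S hS), Nat.card_sigma, ← Finset.sum_coe_sort S]
  refine Finset.sum_congr rfl fun F _ => ?_
  have := Fintype.ofFinite {β : Fin (6 - F.1.card) → ℕ // ∑ j, β j ≤ smoothness (F.1.card - 1)}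
  rw [faceCount, Nat.card_sigma, Nat.card_sigma]
  refine Finset.sum_congr rfl fun β _ => ?_
  have h := ncard_nodeIndex_eq (τ := F.1) (∑ j, β.1 j)
  rwa [Fintype.card_coe] at h

instance finite_dof : Finite (Dof cells) := by
  classical
  have e := dofEquiv (cells := cells) (Finset.univ.filter (IsFace cells))
    fun F hF => (Finset.mem_filter.1 hF).2
  have : Finite {δ : Dof cells // δ.face ∈ Finset.univ.filter (IsFace cells)} := Finite.of_equiv _ e.symm
  refine Finite.of_injective (fun δ : Dof cells =>
    (⟨δ, Finset.mem_filter.2 ⟨Finset.mem_univ _, δ.isFace⟩⟩ :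
      {δ : Dof cells // δ.face ∈ Finset.univ.filter (IsFace cells)})) fun δ δ' h => ?_
  simpa using h

theorem card_dof_subset {K : Finset (Fin V)} (hK : K ∈ cells) (hcard : K.card = 6) :
    Nat.card {δ : Dof cells // δ.face ⊆ K} = 501942 := by
  have h := card_dof_face_mem (cells := cells) (K.powerset.erase ∅) fun F hF => by
    obtain ⟨h1, h2⟩ := Finset.mem_erase.1 hF
    exact ⟨Finset.nonempty_iff_ne_empty.2 h1, K, hK, Finset.mem_powerset.1 h2⟩
  -- The value 0 at the empty set lets the sum over nonempty faces be grouped by cardinality over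
  -- the whole powerset.
  have h2 : ∑ F ∈ K.powerset, (if F.card = 0 then 0 else faceCount F.card) = 501942 := by
    rw [Finset.sum_powerset_apply_card (fun c => if c = 0 then 0 else faceCount c), hcard]
    simp [Finset.sum_range_succ, faceCount_one, faceCount_two, faceCount_three, faceCount_four,
      faceCount_five, faceCount_six, Nat.choose]
  rw [← h2, ← Finset.sum_erase (a := ∅) _ (by simp)]
  refine (Nat.card_congr (Equiv.subtypeEquivRight fun δ => ?_)).trans
    (h.trans (Finset.sum_congr rfl fun F hF => ?_))
  · simp [δ.isFace.1.ne_empty]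
  · rw [if_neg]
    simpa using (Finset.mem_erase.1 hF).1

theorem card_dof_oneCell : Nat.card (Dof oneCell) = 501942 := by
  rw [← card_dof_subset (cells := oneCell) (Finset.mem_singleton_self Finset.univ) (by simp)]
  exact Nat.card_congr (Equiv.subtypeUnivEquiv fun δ => Finset.subset_univ _).symm

theorem ncard_dof_dim (d : ℕ) :
    {δ : Dof oneCell | δ.dim = d}.ncard = Nat.choose 6 (d + 1) * faceCount (d + 1) := by
  have h := card_dof_face_mem (cells := oneCell) (Finset.univ.powersetCard (d + 1)) fun F hF => by
    have := (Finset.mem_powersetCard.1 hF).2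
    exact ⟨Finset.card_pos.1 (by omega), Finset.univ, by simp, Finset.subset_univ F⟩
  have h2 : ∑ F ∈ (Finset.univ : Finset (Fin 6)).powersetCard (d + 1), faceCount F.card =
      Nat.choose 6 (d + 1) * faceCount (d + 1) := by
    rw [Finset.sum_congr rfl fun F hF => by rw [(Finset.mem_powersetCard.1 hF).2],
      Finset.sum_const, Finset.card_powersetCard]
    simp
  rw [← h2, ← h]
  refine Nat.card_congr (Equiv.subtypeEquivRight fun δ => ?_)
  have := δ.isFace.1.card_pos
  simp only [Set.mem_ofPred_eq, Dof.dim, Finset.mem_powersetCard_univ]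
  omega

theorem finrank_P33 : Module.finrank ℝ P33 = 501942 := by
  classical
  have hS : {n : Fin 5 →₀ ℕ | (n.sum fun _ e => e) ≤ 33} =
      ((Finset.range 34).biUnion fun s =>
        Finset.finsuppAntidiag (Finset.univ : Finset (Fin 5)) s : Finset (Fin 5 →₀ ℕ)) := by
    ext n
    simp [Finsupp.sum_fintype, Finset.mem_finsuppAntidiag, Nat.lt_succ_iff]
  have h := Module.finrank_eq_nat_card_basis
    (MvPolynomial.basisRestrictSupport ℝ {n : Fin 5 →₀ ℕ | (n.sum fun _ e => e) ≤ 33})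
  refine h.trans ?_
  rw [hS, Nat.card_coe_set_eq, Set.ncard_coe_finset, Finset.card_biUnion]
  · simp only [Finset.card_finsuppAntidiag_nat_eq_choose, Finset.card_univ, Fintype.card_fin]
    decide +kernel
  · intro s _ s' _ hne
    rw [Function.onFun, Finset.disjoint_left]
    intro β h1 h2
    simp only [Finset.mem_finsuppAntidiag] at h1 h2
    exact hne (h1.1.symm.trans h2.1)

end Count

/-! ### Directional derivatives of polynomials -/

section Operators

theorem pderiv_comm {σ R : Type*} [CommSemiring R] (i j : σ) (p : MvPolynomial σ R) :
    MvPolynomial.pderiv i (MvPolynomial.pderiv j p) =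
      MvPolynomial.pderiv j (MvPolynomial.pderiv i p) := by
  classical
  ext m
  simp only [MvPolynomial.coeff_pderiv, Finsupp.add_apply, add_right_comm m]
  by_cases h : i = j
  · subst h; rfl
  · rw [Finsupp.single_eq_of_ne h, Finsupp.single_eq_of_ne (Ne.symm h)]
    simp only [add_zero]
    ring

theorem dirDeriv_apply (v : E) (p : Poly) :
    dirDeriv v p = ∑ i, v i • MvPolynomial.pderiv i p := by
  simp [dirDeriv, LinearMap.sum_apply]

theorem dirDeriv_add (v w : E) : dirDeriv (v + w) = dirDeriv v + dirDeriv w := by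
  simp [dirDeriv, add_smul, Finset.sum_add_distrib]

theorem dirDeriv_smul (c : ℝ) (v : E) : dirDeriv (c • v) = c • dirDeriv v := by
  simp [dirDeriv, Finset.smul_sum, smul_smul]

theorem dirDeriv_zero : dirDeriv 0 = 0 := by
  simp [dirDeriv]

theorem commute_dirDeriv (v w : E) : Commute (dirDeriv v) (dirDeriv w) := by
  refine LinearMap.ext fun p => ?_
  simp only [Module.End.mul_apply, dirDeriv_apply, map_sum, Derivation.map_smul, smul_smul]
  rw [Finset.sum_comm]
  refine Finset.sum_congr rfl fun i _ => Finset.sum_congr rfl fun j _ => ?_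
  rw [pderiv_comm, mul_comm]

theorem multiDeriv_zero {k : ℕ} (v : Fin k → E) : multiDeriv v 0 = 1 := by
  refine List.prod_eq_one fun x hx => ?_
  obtain ⟨j, rfl⟩ := List.mem_ofFn.1 hx
  rfl

theorem multiDeriv_succ {k : ℕ} (v : Fin (k + 1) → E) (β : Fin (k + 1) → ℕ) :
    multiDeriv v β = dirDeriv (v 0) ^ β 0 *
      multiDeriv (fun j => v j.succ) (fun j => β j.succ) := by
  rw [multiDeriv, List.ofFn_succ, List.prod_cons]
  rfl

theorem commute_dirDeriv_multiDeriv (w : E) {k : ℕ} (v : Fin k → E) (β : Fin k → ℕ) :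
    Commute (dirDeriv w) (multiDeriv v β) := by
  refine Commute.list_prod_right _ _ fun x hx => ?_
  obtain ⟨j, rfl⟩ := List.mem_ofFn.1 hx
  exact (commute_dirDeriv w (v j)).pow_right _

/-- The extra derivative stands on the right and acts first. Inductions on the order can therefore
absorb it into the polynomial. -/
theorem multiDeriv_add_single {k : ℕ} (v : Fin k → E) (β : Fin k → ℕ) (j : Fin k) :
    multiDeriv v (β + Pi.single j 1) = multiDeriv v β * dirDeriv (v j) := by
  induction k with
  | zero => exact j.elim0
  | succ k ih =>
    rw [multiDeriv_succ, multiDeriv_succ v β]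
    refine Fin.cases ?_ (fun j => ?_) j
    · have h : (fun j : Fin k => (β + Pi.single 0 1 : Fin (k + 1) → ℕ) j.succ) =
          fun j => β j.succ := by
        ext j
        simp [Fin.succ_ne_zero]
      rw [h, Pi.add_apply, Pi.single_eq_same, pow_succ, mul_assoc, mul_assoc,
        (commute_dirDeriv_multiDeriv _ _ _).eq]
    · have h : (fun i : Fin k => (β + Pi.single j.succ 1 : Fin (k + 1) → ℕ) i.succ) =
          (fun i => β i.succ) + Pi.single j 1 := by
        ext i
        simp [Pi.single_apply]
      rw [h, ih, Pi.add_apply, Pi.single_eq_of_ne (Fin.succ_ne_zero j).symm, add_zero, mul_assoc]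

theorem exists_eq_add_single {ι : Type*} [Fintype ι] [DecidableEq ι] {s : ℕ} {β : ι → ℕ}
    (h : ∑ j, β j = s + 1) : ∃ (j : ι) (β' : ι → ℕ), β = β' + Pi.single j 1 ∧ ∑ j, β' j = s := by
  obtain ⟨j, -, hj⟩ := Finset.exists_ne_zero_of_sum_ne_zero (h.trans_ne (Nat.succ_ne_zero s))
  have hβ : β = (β - Pi.single j 1) + Pi.single j 1 := by
    ext i
    by_cases hi : i = j
    · subst hi
      simp
      omega
    · simp [Pi.single_eq_of_ne hi]
  refine ⟨j, β - Pi.single j 1, hβ, ?_⟩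
  rw [hβ] at h
  simp only [Pi.add_apply, Finset.sum_add_distrib, Finset.sum_pi_single', Finset.mem_univ,
    if_true] at h
  omega

theorem sum_add_single {ι : Type*} [Fintype ι] [DecidableEq ι] (β : ι → ℕ) (j : ι) :
    ∑ i, (β + Pi.single j 1 : ι → ℕ) i = ∑ i, β i + 1 := by
  simp [Finset.sum_add_distrib]

/-- If all derivatives of order `s` in some directions vanish at a point, then so do those in the
directions spanned by them. -/
theorem evalAt_multiDeriv_eq_zero_of_span {k l : ℕ} {v : Fin k → E} {u : Fin l → E}
    (h : ∀ j, u j ∈ Submodule.span ℝ (Set.range v)) (y : E) (s : ℕ) (p : Poly)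
    (hp : ∀ α : Fin k → ℕ, ∑ i, α i = s → evalAt y (multiDeriv v α p) = 0)
    (β : Fin l → ℕ) (hβ : ∑ j, β j = s) : evalAt y (multiDeriv u β p) = 0 := by
  induction s generalizing p β with
  | zero =>
    have h0 : β = 0 := funext fun j => (Finset.sum_eq_zero_iff.1 hβ) j (Finset.mem_univ j)
    rw [h0, multiDeriv_zero, ← multiDeriv_zero v]
    exact hp 0 (by simp)
  | succ s ih =>
    obtain ⟨j, β', rfl, hβ'⟩ := exists_eq_add_single hβ
    rw [multiDeriv_add_single, Module.End.mul_apply]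
    refine ih _ (fun α hα => ?_) β' hβ'
    have hj := h j
    revert hj
    generalize u j = a
    intro hj
    induction hj using Submodule.span_induction with
    | mem x hx =>
      obtain ⟨i, rfl⟩ := hx
      rw [← Module.End.mul_apply, ← multiDeriv_add_single]
      exact hp _ (by rw [sum_add_single, hα])
    | zero => simp [dirDeriv_zero]
    | add a b _ _ ha hb => rw [dirDeriv_add, LinearMap.add_apply, map_add, map_add, ha, hb, add_zero]
    | smul c a _ ha => rw [dirDeriv_smul, LinearMap.smul_apply, map_smul, map_smul, ha, smul_zero]

end Operators

/-! ### Vanishing order along coordinate planes, and slices -/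

section Slices

variable {ι : Type} [Fintype ι] [DecidableEq ι]

/-- The derivative in direction `w` of a polynomial in the variables `ι`. -/
noncomputable def varDeriv (w : ι → ℝ) (q : MvPolynomial ι ℝ) : MvPolynomial ι ℝ :=
  ∑ i, w i • MvPolynomial.pderiv i q

theorem varDeriv_single (i : ι) (q : MvPolynomial ι ℝ) :
    varDeriv (Pi.single i 1) q = MvPolynomial.pderiv i q := by
  rw [varDeriv, Finset.sum_eq_single i (fun j _ hj => by rw [Pi.single_eq_of_ne hj, zero_smul])
    (by simp), Pi.single_eq_same, one_smul]

theorem varDeriv_add (w w' : ι → ℝ) (q : MvPolynomial ι ℝ) :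
    varDeriv (w + w') q = varDeriv w q + varDeriv w' q := by
  simp [varDeriv, add_smul, Finset.sum_add_distrib]

theorem varDeriv_sum_smul {k : ℕ} (t : Fin k → ℝ) (w : Fin k → ι → ℝ) (q : MvPolynomial ι ℝ) :
    varDeriv (∑ j, t j • w j) q = ∑ j, t j • varDeriv (w j) q := by
  simp only [varDeriv, Finset.sum_apply, Pi.smul_apply, smul_eq_mul, Finset.sum_smul,
    Finset.smul_sum, smul_smul]
  exact Finset.sum_comm

/-- The polynomials vanishing to order `s` along the coordinate plane in which only the
variables in `F` are nonzero. -/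
noncomputable def orderAlong (F : Finset ι) (s : ℕ) : Submodule ℝ (MvPolynomial ι ℝ) :=
  MvPolynomial.restrictSupport ℝ {m | s ≤ ∑ i ∈ Fᶜ, m i}

theorem mem_orderAlong {F : Finset ι} {s : ℕ} {q : MvPolynomial ι ℝ} :
    q ∈ orderAlong F s ↔ ∀ m, q.coeff m ≠ 0 → s ≤ ∑ i ∈ Fᶜ, m i :=
  ⟨fun h _ hm => h (MvPolynomial.mem_support_iff.2 hm),
    fun h m hm => h m (MvPolynomial.mem_support_iff.1 hm)⟩

/-- The polynomials in the variables from `K`. -/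
noncomputable def onVars (K : Finset ι) : Submodule ℝ (MvPolynomial ι ℝ) :=
  MvPolynomial.restrictSupport ℝ {m | ∀ i ∉ K, m i = 0}

theorem mem_onVars {K : Finset ι} {q : MvPolynomial ι ℝ} :
    q ∈ onVars K ↔ ∀ m, q.coeff m ≠ 0 → ∀ i ∉ K, m i = 0 :=
  ⟨fun h _ hm => h (MvPolynomial.mem_support_iff.2 hm),
    fun h m hm => h m (MvPolynomial.mem_support_iff.1 hm)⟩

theorem coeff_ne_zero_of_coeff_pderiv {i : ι} {q : MvPolynomial ι ℝ} {m : ι →₀ ℕ}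
    (h : (MvPolynomial.pderiv i q).coeff m ≠ 0) : q.coeff (m + Finsupp.single i 1) ≠ 0 := by
  rw [MvPolynomial.coeff_pderiv] at h
  exact left_ne_zero_of_mul h

theorem sum_add_finsupp_single (S : Finset ι) (m : ι →₀ ℕ) (i : ι) :
    ∑ j ∈ S, (m + Finsupp.single i 1 : ι →₀ ℕ) j = ∑ j ∈ S, m j + if i ∈ S then 1 else 0 := by
  simp [Finset.sum_add_distrib, Finsupp.single_apply]

theorem pderiv_mem_orderAlong {F : Finset ι} {s : ℕ} {q : MvPolynomial ι ℝ}
    (hq : q ∈ orderAlong F (s + 1)) (i : ι) : MvPolynomial.pderiv i q ∈ orderAlong F s := by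
  rw [mem_orderAlong] at hq ⊢
  intro m hm
  have := hq _ (coeff_ne_zero_of_coeff_pderiv hm)
  rw [sum_add_finsupp_single] at this
  split_ifs at this <;> omega

theorem pderiv_mem_orderAlong_of_mem {F : Finset ι} {s : ℕ} {q : MvPolynomial ι ℝ}
    (hq : q ∈ orderAlong F s) {i : ι} (hi : i ∈ F) : MvPolynomial.pderiv i q ∈ orderAlong F s := by
  rw [mem_orderAlong] at hq ⊢
  intro m hm
  have := hq _ (coeff_ne_zero_of_coeff_pderiv hm)
  rwa [sum_add_finsupp_single, if_neg (by simpa using hi), add_zero] at this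

theorem varDeriv_mem_orderAlong {F : Finset ι} {s : ℕ} {q : MvPolynomial ι ℝ}
    (hq : q ∈ orderAlong F (s + 1)) (w : ι → ℝ) : varDeriv w q ∈ orderAlong F s :=
  Submodule.sum_mem _ fun i _ => Submodule.smul_mem _ _ (pderiv_mem_orderAlong hq i)

theorem varDeriv_mem_orderAlong_of_tangential {F : Finset ι} {s : ℕ} {q : MvPolynomial ι ℝ}
    (hq : q ∈ orderAlong F s) {w : ι → ℝ} (hw : ∀ i ∉ F, w i = 0) :
    varDeriv w q ∈ orderAlong F s := by
  refine Submodule.sum_mem _ fun i _ => ?_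
  by_cases hi : i ∈ F
  · exact Submodule.smul_mem _ _ (pderiv_mem_orderAlong_of_mem hq hi)
  · rw [hw i hi, zero_smul]
    exact Submodule.zero_mem _

theorem pderiv_mem_onVars {K : Finset ι} {q : MvPolynomial ι ℝ} (hq : q ∈ onVars K) (i : ι) :
    MvPolynomial.pderiv i q ∈ onVars K := by
  rw [mem_onVars] at hq ⊢
  intro m hm j hj
  have := hq _ (coeff_ne_zero_of_coeff_pderiv hm) j hj
  rw [Finsupp.add_apply] at this
  omega

theorem pderiv_eq_zero_of_mem_onVars {K : Finset ι} {q : MvPolynomial ι ℝ} (hq : q ∈ onVars K)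
    {i : ι} (hi : i ∉ K) : MvPolynomial.pderiv i q = 0 := by
  ext m
  by_contra h
  have := mem_onVars.1 hq _ (coeff_ne_zero_of_coeff_pderiv (by simpa using h)) i hi
  simp at this

theorem varDeriv_mem_onVars {K : Finset ι} {q : MvPolynomial ι ℝ} (hq : q ∈ onVars K)
    (w : ι → ℝ) : varDeriv w q ∈ onVars K :=
  Submodule.sum_mem _ fun i _ => Submodule.smul_mem _ _ (pderiv_mem_onVars hq i)

theorem eval_eq_zero_of_mem_orderAlong {F : Finset ι} {q : MvPolynomial ι ℝ}
    (hq : q ∈ orderAlong F 1) {y : ι → ℝ} (hy : ∀ i ∉ F, y i = 0) :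
    MvPolynomial.eval y q = 0 := by
  rw [MvPolynomial.eval_eq']
  refine Finset.sum_eq_zero fun m hm => ?_
  have h1 := mem_orderAlong.1 hq m (MvPolynomial.mem_support_iff.1 hm)
  obtain ⟨i, hi, hmi⟩ := Finset.exists_ne_zero_of_sum_ne_zero (Nat.pos_iff_ne_zero.1 h1)
  rw [Finset.prod_eq_zero (Finset.mem_univ i), mul_zero]
  rw [hy i (Finset.mem_compl.1 hi), zero_pow hmi]

/-- A polynomial regarded as a polynomial in the variables off `F` whose coefficients are
polynomials in the variables in `F`. -/
noncomputable def separate (F : Finset ι) :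
    MvPolynomial ι ℝ →ₐ[ℝ] MvPolynomial ι (MvPolynomial F ℝ) :=
  MvPolynomial.aeval fun i =>
    if h : i ∈ F then MvPolynomial.C (MvPolynomial.X ⟨i, h⟩) else MvPolynomial.X i

/-- The coefficient of a monomial in the variables off `F`. -/
noncomputable def slice (F : Finset ι) (κ : ι →₀ ℕ) (q : MvPolynomial ι ℝ) : MvPolynomial F ℝ :=
  (separate F q).coeff κ

theorem separate_X (F : Finset ι) (i : ι) : separate F (MvPolynomial.X i) =
    if h : i ∈ F then MvPolynomial.C (MvPolynomial.X ⟨i, h⟩) else MvPolynomial.X i :=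
  MvPolynomial.aeval_X _ _

theorem separate_C (F : Finset ι) (a : ℝ) : separate F (MvPolynomial.C a) =
    MvPolynomial.C (MvPolynomial.C a) :=
  (separate F).commutes a

theorem slice_add (F : Finset ι) (κ : ι →₀ ℕ) (p q : MvPolynomial ι ℝ) :
    slice F κ (p + q) = slice F κ p + slice F κ q := by
  rw [slice, map_add, MvPolynomial.coeff_add]
  rfl

theorem slice_smul (F : Finset ι) (κ : ι →₀ ℕ) (c : ℝ) (q : MvPolynomial ι ℝ) :
    slice F κ (c • q) = c • slice F κ q := by
  rw [slice, map_smul, MvPolynomial.coeff_smul]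
  rfl

theorem slice_zero (F : Finset ι) (κ : ι →₀ ℕ) : slice F κ 0 = 0 := by
  rw [slice, map_zero, MvPolynomial.coeff_zero]

theorem slice_sum {α : Type*} (F : Finset ι) (κ : ι →₀ ℕ) (S : Finset α)
    (f : α → MvPolynomial ι ℝ) : slice F κ (∑ j ∈ S, f j) = ∑ j ∈ S, slice F κ (f j) := by
  rw [slice, map_sum, MvPolynomial.coeff_sum]
  rfl

/-- The variables of `F` have become coefficients, which are constants for a derivative in a
variable off `F`. -/
theorem separate_pderiv {F : Finset ι} {i : ι} (hi : i ∉ F) (q : MvPolynomial ι ℝ) :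
    separate F (MvPolynomial.pderiv i q) = MvPolynomial.pderiv i (separate F q) := by
  induction q using MvPolynomial.induction_on with
  | C a => rw [separate_C, MvPolynomial.pderiv_C, MvPolynomial.pderiv_C, map_zero]
  | add p q hp hq => rw [map_add, map_add, hp, hq, map_add, map_add]
  | mul_X p j hp =>
    rw [MvPolynomial.pderiv_mul, map_add, map_mul, map_mul, hp, map_mul, MvPolynomial.pderiv_mul]
    congr 2
    rw [separate_X, MvPolynomial.pderiv_X]
    split_ifs with hj
    · rw [MvPolynomial.pderiv_C, Pi.single_eq_of_ne (by rintro rfl; exact hi hj), map_zero]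
    · rw [MvPolynomial.pderiv_X, Pi.single_apply, Pi.single_apply]
      split_ifs
      · exact map_one _
      · exact map_zero _

/-- Lowers the order of a slice by one at the price of a nonzero factor; this drives the induction
in `Barycentric.eval_slice_eq_zero`. -/
theorem slice_pderiv {F : Finset ι} {i : ι} (hi : i ∉ F) (κ : ι →₀ ℕ) (q : MvPolynomial ι ℝ) :
    slice F κ (MvPolynomial.pderiv i q) = slice F (κ + Finsupp.single i 1) q * (κ i + 1) := by
  rw [slice, separate_pderiv hi, MvPolynomial.coeff_pderiv]
  rfl

theorem eval_slice_zero {F : Finset ι} {y : ι → ℝ} (hy : ∀ i ∉ F, y i = 0)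
    (q : MvPolynomial ι ℝ) :
    MvPolynomial.eval (fun i : F => y i) (slice F 0 q) = MvPolynomial.eval y q := by
  induction q using MvPolynomial.induction_on with
  | C a => simp [slice]
  | add p q hp hq => rw [slice_add, map_add, hp, hq, map_add]
  | mul_X p j hp =>
    have h0 : ∀ r r' : MvPolynomial ι (MvPolynomial F ℝ),
        (r * r').coeff 0 = r.coeff 0 * r'.coeff 0 := fun r r' => by
      simp only [← MvPolynomial.constantCoeff_eq, map_mul]
    rw [slice, map_mul, h0, map_mul, map_mul, MvPolynomial.eval_X]
    change MvPolynomial.eval _ (slice F 0 p) * _ = _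
    rw [hp, separate_X]
    congr 1
    split_ifs with h
    · simp
    · simp [hy j h]

/-- The exponent that is `γ` on `F` and `κ` off `F`. -/
noncomputable def glue {F : Finset ι} (γ : F →₀ ℕ) (κ : ι →₀ ℕ) : ι →₀ ℕ :=
  Finsupp.equivFunOnFinite.symm fun i => if h : i ∈ F then γ ⟨i, h⟩ else κ i

theorem glue_apply_mem {F : Finset ι} (γ : F →₀ ℕ) (κ : ι →₀ ℕ) {i : ι} (h : i ∈ F) :
    glue γ κ i = γ ⟨i, h⟩ := by
  simp [glue, h]

theorem glue_apply_notMem {F : Finset ι} (γ : F →₀ ℕ) (κ : ι →₀ ℕ) {i : ι} (h : i ∉ F) :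
    glue γ κ i = κ i := by
  simp [glue, h]

theorem coeff_slice {F : Finset ι} {κ : ι →₀ ℕ} (hκ : ∀ i ∈ F, κ i = 0) (γ : F →₀ ℕ)
    (q : MvPolynomial ι ℝ) : (slice F κ q).coeff γ = q.coeff (glue γ κ) := by
  induction q using MvPolynomial.induction_on generalizing γ κ with
  | C a =>
    rw [slice, separate_C, MvPolynomial.coeff_C, MvPolynomial.coeff_C]
    by_cases h0 : κ = 0
    · subst h0
      rw [if_pos rfl, MvPolynomial.coeff_C]
      refine if_congr ⟨?_, fun h => ?_⟩ rfl rfl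
      · rintro rfl
        ext i
        by_cases hi : i ∈ F
        · simp [glue_apply_mem _ _ hi]
        · simp [glue_apply_notMem _ _ hi]
      · ext i
        have := DFunLike.congr_fun h i.1
        rw [glue_apply_mem _ _ i.2] at this
        simpa using this
    · rw [if_neg (Ne.symm h0), if_neg, MvPolynomial.coeff_zero]
      intro h
      refine h0 (Finsupp.ext fun i => ?_)
      by_cases hi : i ∈ F
      · simp [hκ i hi]
      · have := DFunLike.congr_fun h i
        rw [glue_apply_notMem _ _ hi] at this
        simpa using this.symm
  | add p q hp hq => rw [slice_add, MvPolynomial.coeff_add, MvPolynomial.coeff_add, hp hκ, hq hκ]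
  | mul_X p j hp =>
    rw [slice, map_mul, separate_X, MvPolynomial.coeff_mul_X']
    by_cases hj : j ∈ F
    · rw [dif_pos hj, mul_comm, MvPolynomial.coeff_C_mul, mul_comm, MvPolynomial.coeff_mul_X']
      simp only [Finsupp.mem_support_iff, glue_apply_mem γ κ hj]
      refine if_congr Iff.rfl ((hp hκ _).trans ?_) rfl
      congr 1
      ext i
      by_cases hi : i ∈ F
      · rw [glue_apply_mem _ _ hi, Finsupp.tsub_apply, Finsupp.tsub_apply, glue_apply_mem _ _ hi]
        simp [Finsupp.single_apply, Subtype.ext_iff]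
      · have : j ≠ i := fun h => hi (h ▸ hj)
        simp [glue_apply_notMem _ _ hi, this]
    · rw [dif_neg hj, MvPolynomial.coeff_mul_X']
      simp only [Finsupp.mem_support_iff, glue_apply_notMem γ κ hj]
      split_ifs with hne
      · refine (hp (fun i hi => by simp [hκ i hi]) _).trans ?_
        congr 1
        ext i
        by_cases hi : i ∈ F
        · have : j ≠ i := fun h => hj (h ▸ hi)
          simp [glue_apply_mem _ _ hi, this]
        · simp [glue_apply_notMem _ _ hi]
      · exact MvPolynomial.coeff_zero _

theorem sum_compl_glue {F : Finset ι} (γ : F →₀ ℕ) (κ : ι →₀ ℕ) :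
    ∑ i ∈ Fᶜ, glue γ κ i = ∑ i ∈ Fᶜ, κ i :=
  Finset.sum_congr rfl fun _ hi => glue_apply_notMem _ _ (Finset.mem_compl.1 hi)

theorem slice_eq_zero_of_mem_orderAlong {F : Finset ι} {s : ℕ} {q : MvPolynomial ι ℝ}
    (hq : q ∈ orderAlong F s) {κ : ι →₀ ℕ} (hκ : ∀ i ∈ F, κ i = 0) (hs : ∑ i, κ i < s) :
    slice F κ q = 0 := by
  ext γ
  rw [coeff_slice hκ, MvPolynomial.coeff_zero]
  by_contra h
  have h1 := mem_orderAlong.1 hq _ h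
  rw [sum_compl_glue] at h1
  have := Finset.sum_le_sum_of_subset (f := fun i => κ i) (Finset.subset_univ Fᶜ)
  omega

end Slices

/-! ### Barycentric coordinates, normal frames and slices -/

section Barycentric

variable {V : ℕ}

/-- Barycentric coordinates of the simplex with vertices `x i`, `i ∈ K`, continued by zero to the
other indices. -/
structure Barycentric (x : Fin V → E) (K : Finset (Fin V)) where
  coord : Fin V → E →ᵃ[ℝ] ℝ
  coord_eq_zero : ∀ i ∉ K, coord i = 0
  coord_vertex : ∀ i ∈ K, ∀ k ∈ K, coord i (x k) = if i = k then 1 else 0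
  sum_coord : ∀ y, ∑ i, coord i y = 1
  sum_coord_smul : ∀ y, ∑ i, coord i y • x i = y

theorem nonempty_barycentric {x : Fin V → E} {K : Finset (Fin V)} (hK : K.card = 6)
    (hx : AffineIndependent ℝ fun i : K => x i) : Nonempty (Barycentric x K) := by
  have htop : affineSpan ℝ (Set.range fun i : K => x i) = ⊤ := by
    rw [hx.affineSpan_eq_top_iff_card_eq_finrank_add_one, Fintype.card_coe, hK]
    simp
  let b : AffineBasis K ℝ E := ⟨fun i => x i, hx, htop⟩
  have hsum : ∀ {M : Type} [AddCommMonoid M] (f : Fin V → M), (∀ i ∉ K, f i = 0) →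
      ∑ i, f i = ∑ i : K, f i := fun f hf => by
    rw [Finset.sum_coe_sort K f]
    exact (Finset.sum_subset (Finset.subset_univ K) fun i _ hi => hf i hi).symm
  refine ⟨⟨fun i => if h : i ∈ K then b.coord ⟨i, h⟩ else 0, fun i hi => dif_neg hi, ?_, ?_, ?_⟩⟩
  · intro i hi k hk
    rw [dif_pos hi]
    refine (b.coord_apply ⟨i, hi⟩ ⟨k, hk⟩).trans ?_
    simp
  · intro y
    rw [hsum _ fun i hi => by rw [dif_neg hi]; rfl]
    simpa using b.sum_coord_apply_eq_one y
  · intro y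
    rw [hsum _ fun i hi => by rw [dif_neg hi]; exact zero_smul _ _]
    refine Eq.trans (Finset.sum_congr rfl fun i _ => ?_) (b.linear_combination_coord_eq_self y)
    rw [dif_pos i.2]
    rfl

namespace Barycentric

variable {x : Fin V → E} {K : Finset (Fin V)} (B : Barycentric x K)

/-- The barycentric coordinates of a direction. -/
noncomputable def dir (v : E) : Fin V → ℝ := fun i => (B.coord i).linear v

theorem coord_eq (i : Fin V) (y : E) : B.coord i y = (B.coord i).linear y + B.coord i 0 := by
  have := (B.coord i).map_vadd 0 y
  simpa using this

theorem coord_vertex_of_notMem {F : Finset (Fin V)} (hF : F ⊆ K) {i k : Fin V} (hi : i ∉ F)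
    (hk : k ∈ F) : B.coord i (x k) = 0 := by
  by_cases h : i ∈ K
  · rw [B.coord_vertex i h k (hF hk), if_neg]
    rintro rfl
    exact hi hk
  · rw [B.coord_eq_zero i h]
    rfl

theorem dir_sub (a b : E) (i : Fin V) : B.dir (a - b) i = B.coord i a - B.coord i b := by
  rw [dir, map_sub, B.coord_eq i a, B.coord_eq i b]
  ring

theorem dir_add (a b : E) : B.dir (a + b) = B.dir a + B.dir b :=
  funext fun _ => map_add _ a b

theorem dir_sum_smul {k : ℕ} (t : Fin k → ℝ) (v : Fin k → E) :
    B.dir (∑ j, t j • v j) = ∑ j, t j • B.dir (v j) := by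
  ext i
  simp [dir, Finset.sum_apply]

/-- The barycentric coordinate as a polynomial. -/
noncomputable def poly (i : Fin V) : Poly :=
  MvPolynomial.C (B.coord i 0) +
    ∑ j, MvPolynomial.C (B.dir (EuclideanSpace.single j 1) i) * MvPolynomial.X j

theorem dir_eq_sum (v : E) (i : Fin V) :
    B.dir v i = ∑ j, B.dir (EuclideanSpace.single j 1) i * v j := by
  have hv : v = ∑ j, v j • EuclideanSpace.single j (1 : ℝ) := by
    ext l
    simp [Finset.sum_apply, Pi.single_apply]
  conv_lhs => rw [hv]
  simp only [dir, map_sum, map_smul, smul_eq_mul]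
  exact Finset.sum_congr rfl fun j _ => mul_comm _ _

theorem evalAt_poly (y : E) (i : Fin V) : evalAt y (B.poly i) = B.coord i y := by
  have : evalAt y (B.poly i) = MvPolynomial.aeval (fun i => y i) (B.poly i) := rfl
  rw [this, poly, B.coord_eq i y, map_add, map_sum]
  change _ = B.dir y i + _
  rw [dir_eq_sum]
  simp [add_comm]

/-- The polynomial in `ℝ⁵` with the given expression in barycentric coordinates. -/
noncomputable def toPoly : MvPolynomial (Fin V) ℝ →ₐ[ℝ] Poly := MvPolynomial.aeval B.poly

theorem evalAt_toPoly (y : E) (q : MvPolynomial (Fin V) ℝ) :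
    evalAt y (B.toPoly q) = MvPolynomial.eval (fun i => B.coord i y) q := by
  have h : (MvPolynomial.aeval fun i => y i).comp B.toPoly =
      (MvPolynomial.aeval fun i => B.coord i y : MvPolynomial (Fin V) ℝ →ₐ[ℝ] ℝ) := by
    refine MvPolynomial.algHom_ext fun i => ?_
    rw [AlgHom.comp_apply, toPoly, MvPolynomial.aeval_X, MvPolynomial.aeval_X]
    exact B.evalAt_poly y i
  exact DFunLike.congr_fun h q

theorem dirDeriv_poly (v : E) (i : Fin V) :
    dirDeriv v (B.poly i) = MvPolynomial.C (B.dir v i) := by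
  rw [dirDeriv_apply, poly, dir_eq_sum, map_sum]
  refine Finset.sum_congr rfl fun j _ => ?_
  rw [map_add, MvPolynomial.pderiv_C, zero_add, map_sum, Finset.sum_eq_single j]
  · rw [MvPolynomial.pderiv_C_mul, MvPolynomial.pderiv_X_self, mul_one, MvPolynomial.smul_eq_C_mul,
      ← map_mul, mul_comm]
  · intro l _ hl
    rw [MvPolynomial.pderiv_C_mul, MvPolynomial.pderiv_X_of_ne hl, mul_zero]
  · simp

theorem dirDeriv_mul (v : E) (p q : Poly) :
    dirDeriv v (p * q) = dirDeriv v p * q + p * dirDeriv v q := by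
  simp only [dirDeriv_apply, MvPolynomial.pderiv_mul, smul_add, Finset.sum_add_distrib,
    Finset.sum_mul, Finset.mul_sum, smul_mul_assoc, mul_smul_comm]

theorem dirDeriv_toPoly (v : E) (q : MvPolynomial (Fin V) ℝ) :
    dirDeriv v (B.toPoly q) = B.toPoly (varDeriv (B.dir v) q) := by
  induction q using MvPolynomial.induction_on with
  | C a =>
    have h1 : B.toPoly (MvPolynomial.C a) = MvPolynomial.C a := B.toPoly.commutes a
    rw [h1, dirDeriv_apply, varDeriv]
    simp
  | add p q hp hq =>
    rw [map_add, map_add, hp, hq, ← map_add]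
    simp [varDeriv, Finset.sum_add_distrib]
  | mul_X p i hp =>
    have hX : B.toPoly (MvPolynomial.X i) = B.poly i := MvPolynomial.aeval_X _ _
    have h1 : varDeriv (B.dir v) (p * MvPolynomial.X i) =
        varDeriv (B.dir v) p * MvPolynomial.X i + p * MvPolynomial.C (B.dir v i) := by
      simp only [varDeriv, MvPolynomial.pderiv_mul, smul_add, Finset.sum_add_distrib,
        Finset.sum_mul, smul_mul_assoc]
      congr 1
      rw [Finset.sum_eq_single i]
      · rw [MvPolynomial.pderiv_X_self, mul_one, MvPolynomial.smul_eq_C_mul, mul_comm]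
      · intro l _ hl
        rw [MvPolynomial.pderiv_X_of_ne hl.symm, mul_zero, smul_zero]
      · simp
    have h2 : B.toPoly (MvPolynomial.C (B.dir v i)) = MvPolynomial.C (B.dir v i) :=
      B.toPoly.commutes _
    rw [map_mul, dirDeriv_mul, hp, h1, map_add, map_mul, map_mul, hX, dirDeriv_poly, h2]

theorem toPoly_eq_of_evalAt {q : MvPolynomial (Fin V) ℝ} {p : Poly}
    (h : ∀ y : E, MvPolynomial.eval (fun i => B.coord i y) q = evalAt y p) : B.toPoly q = p := by
  refine MvPolynomial.funext fun f => ?_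
  have := h (WithLp.toLp 2 f)
  rw [← B.evalAt_toPoly] at this
  exact this

/-- Every polynomial of degree at most `n` is homogeneous of degree `n` in barycentric
coordinates. -/
theorem exists_homogeneous {n : ℕ} {p : Poly} (hp : p.totalDegree ≤ n) :
    ∃ q : MvPolynomial (Fin V) ℝ, B.toPoly q = p ∧ q.IsHomogeneous n ∧ q ∈ onVars K := by
  set one : MvPolynomial (Fin V) ℝ := ∑ i ∈ K, MvPolynomial.X i with hone
  set co : Fin 5 → MvPolynomial (Fin V) ℝ := fun j =>
    ∑ i ∈ K, MvPolynomial.C (x i j) * MvPolynomial.X i with hco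
  have hX : ∀ i ∈ K, (MvPolynomial.X i : MvPolynomial (Fin V) ℝ) ∈
      MvPolynomial.supported ℝ (K : Set (Fin V)) := fun i hi =>
    MvPolynomial.X_mem_supported.2 (Finset.mem_coe.2 hi)
  have hsub : ∀ y : E, ∀ i ∉ K, B.coord i y = 0 := fun y i hi => by rw [B.coord_eq_zero i hi]; rfl
  have hone_eval : ∀ y : E, MvPolynomial.eval (fun i => B.coord i y) one = 1 := by
    intro y
    rw [hone, map_sum, ← B.sum_coord y]
    simp only [MvPolynomial.eval_X]
    exact Finset.sum_subset (Finset.subset_univ K) fun i _ hi => hsub y i hi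
  have hco_eval : ∀ (y : E) (j : Fin 5), MvPolynomial.eval (fun i => B.coord i y) (co j) = y j := by
    intro y j
    conv_rhs => rw [← B.sum_coord_smul y]
    rw [hco, map_sum]
    simp only [map_mul, MvPolynomial.eval_X, MvPolynomial.eval_C, WithLp.ofLp_sum, WithLp.ofLp_smul,
      Finset.sum_apply, Pi.smul_apply, smul_eq_mul]
    rw [Finset.sum_subset (Finset.subset_univ K) fun i _ hi => by rw [hsub y i hi, mul_zero]]
    exact Finset.sum_congr rfl fun i _ => mul_comm _ _
  -- Each Cartesian coordinate is replaced by its linear form in the barycentric coordinates, and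
  -- each monomial is padded to degree `n` by powers of their sum, which equals 1.
  refine ⟨∑ m ∈ p.support, MvPolynomial.C (p.coeff m) *
    (one ^ (n - m.degree) * ∏ j, co j ^ m j), ?_, ?_, ?_⟩
  · refine B.toPoly_eq_of_evalAt fun y => ?_
    have h1 : evalAt y p = MvPolynomial.eval (fun i => y i) p := rfl
    rw [h1, MvPolynomial.eval_eq' _ p, map_sum]
    simp only [map_mul, map_pow, map_prod, hone_eval, hco_eval, MvPolynomial.eval_C, one_pow,
      one_mul]
  · refine MvPolynomial.IsHomogeneous.sum _ _ _ fun m hm => ?_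
    have h1 : one.IsHomogeneous 1 :=
      MvPolynomial.IsHomogeneous.sum _ _ _ fun i _ => MvPolynomial.isHomogeneous_X _ _
    have h2 : ∀ j, (co j).IsHomogeneous 1 := fun j =>
      MvPolynomial.IsHomogeneous.sum _ _ _ fun i _ => MvPolynomial.isHomogeneous_C_mul_X _ _
    have h3 : (∏ j, co j ^ m j).IsHomogeneous (∑ j, m j) :=
      MvPolynomial.IsHomogeneous.prod _ _ _ fun j _ => by simpa using (h2 j).pow (m j)
    have hdeg : m.degree ≤ n := (MvPolynomial.le_totalDegree hm).trans hp
    have h4 := ((h1.pow (n - m.degree)).mul h3).C_mul (p.coeff m)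
    convert h4 using 1
    rw [← Finsupp.degree_eq_sum]
    omega
  · have hmem : (∑ m ∈ p.support, MvPolynomial.C (p.coeff m) *
        (one ^ (n - m.degree) * ∏ j, co j ^ m j)) ∈
        MvPolynomial.supported ℝ (K : Set (Fin V)) := by
      have hC : ∀ a : ℝ, MvPolynomial.C a ∈ MvPolynomial.supported ℝ (K : Set (Fin V)) := fun a =>
        Subalgebra.algebraMap_mem _ a
      exact Subalgebra.sum_mem _ fun m _ => Subalgebra.mul_mem _ (hC _) (Subalgebra.mul_mem _
        (Subalgebra.pow_mem _ (Subalgebra.sum_mem _ fun i hi => hX i hi) _)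
        (Subalgebra.prod_mem _ fun j _ => Subalgebra.pow_mem _ (Subalgebra.sum_mem _
          fun i hi => Subalgebra.mul_mem _ (hC _) (hX i hi)) _))
    rw [MvPolynomial.mem_supported] at hmem
    rw [mem_onVars]
    intro m hm i hi
    by_contra hne
    exact hi (hmem ((MvPolynomial.mem_vars_iff_mem_support i).2 ⟨m, MvPolynomial.mem_support_iff.2 hm,
      Finsupp.mem_support_iff.2 hne⟩))

theorem coord_eq_zero_of_mem_convexHull {F : Finset (Fin V)} (hF : F ⊆ K) {y : E}
    (hy : y ∈ convexHull ℝ (x '' (F : Set (Fin V)))) {i : Fin V} (hi : i ∉ F) :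
    B.coord i y = 0 := by
  have hconv : Convex ℝ ((B.coord i) ⁻¹' {0}) := (convex_singleton 0).affine_preimage _
  refine convexHull_min ?_ hconv hy
  rintro _ ⟨k, hk, rfl⟩
  exact B.coord_vertex_of_notMem hF hi hk

/-- Derivatives along a face of a polynomial vanishing there to a higher order. -/
theorem evalAt_multiDeriv_toPoly_eq_zero {F : Finset (Fin V)} {y : E}
    (hy : ∀ i ∉ F, B.coord i y = 0) {k : ℕ} (v : Fin k → E) (s : ℕ)
    (q : MvPolynomial (Fin V) ℝ) (hq : q ∈ orderAlong F (s + 1)) (β : Fin k → ℕ)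
    (hβ : ∑ j, β j = s) : evalAt y (multiDeriv v β (B.toPoly q)) = 0 := by
  induction s generalizing q β with
  | zero =>
    have h0 : β = 0 := funext fun j => (Finset.sum_eq_zero_iff.1 hβ) j (Finset.mem_univ j)
    rw [h0, multiDeriv_zero, Module.End.one_apply, evalAt_toPoly]
    exact eval_eq_zero_of_mem_orderAlong hq hy
  | succ s ih =>
    obtain ⟨j, β', rfl, hβ'⟩ := exists_eq_add_single hβ
    rw [multiDeriv_add_single, Module.End.mul_apply, dirDeriv_toPoly]
    exact ih _ (varDeriv_mem_orderAlong hq _) β' hβ'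

theorem dir_eq_zero_of_mem_vectorSpan {F : Finset (Fin V)} (hF : F ⊆ K) {v : E}
    (hv : v ∈ vectorSpan ℝ (x '' (F : Set (Fin V)))) {i : Fin V} (hi : i ∉ F) :
    B.dir v i = 0 := by
  have hle : vectorSpan ℝ (x '' (F : Set (Fin V))) ≤ LinearMap.ker (B.coord i).linear := by
    rw [vectorSpan_def, Submodule.span_le]
    rintro _ ⟨_, ⟨a, ha, rfl⟩, _, ⟨b, hb, rfl⟩, rfl⟩
    rw [SetLike.mem_coe, LinearMap.mem_ker]
    refine (B.dir_sub (x a) (x b) i).trans ?_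
    rw [B.coord_vertex_of_notMem hF hi ha, B.coord_vertex_of_notMem hF hi hb, sub_zero]
  exact hle hv

/-- A normal frame of a face and the directions of the face span all directions. -/
theorem exists_dir_decomposition (hx : AffineIndependent ℝ fun i : K => x i)
    {F : Finset (Fin V)} (hF : F ⊆ K) (hne : F.Nonempty) (hcard : K.card = 6)
    {ν : Fin (6 - F.card) → E} (hν : LinearIndependent ℝ ν)
    (horth : ∀ j, ∀ a ∈ F, ∀ b ∈ F, inner ℝ (ν j) (x a - x b) = 0) {i : Fin V} (hi : i ∈ K) :
    ∃ (t : Fin (6 - F.card) → ℝ) (w : Fin V → ℝ), (∀ j ∉ F, w j = 0) ∧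
      Pi.single i 1 = ∑ j, t j • B.dir (ν j) + w := by
  obtain ⟨a, ha⟩ := hne
  set W := vectorSpan ℝ (x '' (F : Set (Fin V))) with hW
  have hFcard : F.card ≤ 6 := hcard ▸ Finset.card_le_card hF
  have hFpos : 0 < F.card := Finset.card_pos.2 ⟨a, ha⟩
  have hWrank : Module.finrank ℝ W = F.card - 1 := by
    have h1 : AffineIndependent ℝ fun i : F => x i :=
      hx.comp_embedding ⟨fun i : F => (⟨i.1, hF i.2⟩ : K),
        fun i j h => Subtype.ext (congrArg (fun k : K => k.1) h)⟩
    have h2 := h1.finrank_vectorSpan (n := F.card - 1) (by rw [Fintype.card_coe]; omega)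
    rwa [show Set.range (fun i : F => x i) = x '' (F : Set (Fin V)) by
      ext y; simp] at h2
  have hspan : Submodule.span ℝ (Set.range ν) = Wᗮ := by
    refine Submodule.eq_of_le_of_finrank_eq ?_ ?_
    · rw [Submodule.span_le]
      rintro _ ⟨j, rfl⟩
      rw [SetLike.mem_coe, Submodule.mem_orthogonal]
      intro u hu
      rw [real_inner_comm]
      have hle : W ≤ LinearMap.ker (innerₛₗ ℝ (ν j)) := by
        rw [hW, vectorSpan_def, Submodule.span_le]
        rintro _ ⟨_, ⟨a, ha, rfl⟩, _, ⟨b, hb, rfl⟩, rfl⟩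
        rw [SetLike.mem_coe, LinearMap.mem_ker]
        exact horth j a ha b hb
      exact hle hu
    · rw [finrank_span_eq_card hν, Fintype.card_fin]
      have := W.finrank_add_finrank_orthogonal
      rw [hWrank] at this
      simp at this
      omega
  obtain ⟨u, hu, n, hn, hsum⟩ := Submodule.mem_sup.1
    (show x i - x a ∈ W ⊔ Wᗮ by rw [Submodule.sup_orthogonal_of_hasOrthogonalProjection]; trivial)
  rw [← hspan, Submodule.mem_span_range_iff_exists_fun] at hn
  obtain ⟨t, rfl⟩ := hn
  -- A unit vector has coordinate sum 1 and is not the barycentric form of a direction in space, but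
  -- its difference with the unit vector at `a` is. The correction at `a` is harmless because `a`
  -- lies in `F`.
  refine ⟨t, B.dir u + Pi.single a 1, fun j hj => ?_, ?_⟩
  · rw [Pi.add_apply, B.dir_eq_zero_of_mem_vectorSpan hF hu hj, Pi.single_eq_of_ne, add_zero]
    rintro rfl
    exact hj ha
  · have hd : B.dir (x i - x a) = Pi.single i 1 - Pi.single a 1 := by
      ext k
      rw [dir_sub, Pi.sub_apply, Pi.single_apply, Pi.single_apply]
      by_cases hk : k ∈ K
      · rw [B.coord_vertex k hk i hi, B.coord_vertex k hk a (hF ha)]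
      · rw [B.coord_vertex_of_notMem subset_rfl hk hi,
          B.coord_vertex_of_notMem subset_rfl hk (hF ha), if_neg, if_neg]
        · rintro rfl; exact hk (hF ha)
        · rintro rfl; exact hk hi
    rw [← hsum, dir_add, dir_sum_smul] at hd
    rw [eq_sub_iff_add_eq] at hd
    rw [← hd]
    abel

/-- If all normal derivatives of order `s` of a polynomial vanishing to order `s` along a face
vanish at a point of the face, then so do all its slices of order `s`. -/
theorem eval_slice_eq_zero {F : Finset (Fin V)} {k : ℕ} {ν : Fin k → E}
    (hdec : ∀ i ∈ K, ∃ (t : Fin k → ℝ) (w : Fin V → ℝ), (∀ j ∉ F, w j = 0) ∧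
      Pi.single i 1 = ∑ j, t j • B.dir (ν j) + w) {y : E} (hy : ∀ i ∉ F, B.coord i y = 0)
    (s : ℕ) (q : MvPolynomial (Fin V) ℝ) (hq : q ∈ orderAlong F s) (hqK : q ∈ onVars K)
    (h : ∀ β : Fin k → ℕ, ∑ j, β j = s → evalAt y (multiDeriv ν β (B.toPoly q)) = 0)
    (κ : Fin V →₀ ℕ) (hκ : ∀ i ∈ F, κ i = 0) (hκs : ∑ i, κ i = s) :
    MvPolynomial.eval (fun i : F => B.coord i y) (slice F κ q) = 0 := by
  induction s generalizing q κ with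
  | zero =>
    have h0 : κ = 0 := Finsupp.ext fun j => (Finset.sum_eq_zero_iff.1 hκs) j (Finset.mem_univ j)
    have := h 0 (by simp)
    rw [multiDeriv_zero, Module.End.one_apply, evalAt_toPoly] at this
    rw [h0, eval_slice_zero (y := fun i => B.coord i y) hy, this]
  | succ s ih =>
    obtain ⟨i, κ', hκ', hκ's⟩ := exists_eq_add_single hκs
    set κ₁ : Fin V →₀ ℕ := Finsupp.equivFunOnFinite.symm κ' with hκ₁
    have hκe : κ = κ₁ + Finsupp.single i 1 := by
      ext j
      rw [hκ']
      simp [hκ₁, Pi.single_apply, Finsupp.single_apply, eq_comm]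
    have hi : i ∉ F := fun hi => by
      have := hκ i hi
      rw [hκe] at this
      simp at this
    have hκ₁0 : ∀ j ∈ F, κ₁ j = 0 := fun j hj => by
      have := hκ j hj
      rw [hκe, Finsupp.add_apply] at this
      omega
    have hκ₁s : ∑ j, κ₁ j = s := hκ's
    have hmain : MvPolynomial.eval (fun i : F => B.coord i y)
        (slice F κ₁ (MvPolynomial.pderiv i q)) = 0 := by
      by_cases hiK : i ∈ K
      · obtain ⟨t, w, hw, hdec⟩ := hdec i hiK
        -- The tangential part keeps vanishing order `s + 1`, so its slice of order `s` is zero. The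
        -- normal parts lose one order and fall under the induction hypothesis.
        rw [← varDeriv_single, hdec, varDeriv_add, varDeriv_sum_smul, slice_add, slice_sum,
          map_add, map_sum,
          slice_eq_zero_of_mem_orderAlong (varDeriv_mem_orderAlong_of_tangential hq hw) hκ₁0
            (by omega), map_zero, add_zero]
        refine Finset.sum_eq_zero fun j _ => ?_
        rw [slice_smul, MvPolynomial.smul_eval, ih _ (varDeriv_mem_orderAlong hq _)
          (varDeriv_mem_onVars hqK _) (fun β hβ => ?_) κ₁ hκ₁0 hκ₁s, mul_zero]
        rw [← dirDeriv_toPoly, ← Module.End.mul_apply, ← multiDeriv_add_single]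
        exact h _ (by rw [sum_add_single, hβ])
      · rw [pderiv_eq_zero_of_mem_onVars hqK hiK, slice_zero, map_zero]
    rw [slice_pderiv hi, ← hκe, map_mul] at hmain
    refine (mul_eq_zero.1 hmain).resolve_right ?_
    rw [map_add, map_one, map_natCast]
    positivity

end Barycentric

end Barycentric

/-! ### Unisolvence on one simplex -/

section Unisolvence

variable {V : ℕ} {x : Fin V → E} {K : Finset (Fin V)}

theorem Barycentric.coord_sum_smul (B : Barycentric x K) {F : Finset (Fin V)} (hF : F ⊆ K)
    {c : F → ℝ} (hc : ∑ k, c k = 1) (i : Fin V) :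
    B.coord i (∑ k : F, c k • x k) = if h : i ∈ F then c ⟨i, h⟩ else 0 := by
  have h1 : B.coord i (∑ k : F, c k • x k) = ∑ k : F, c k * B.coord i (x k) := by
    rw [B.coord_eq, map_sum, ← one_mul (B.coord i 0), ← hc, Finset.sum_mul,
      ← Finset.sum_add_distrib]
    refine Finset.sum_congr rfl fun k _ => ?_
    rw [map_smul, smul_eq_mul, B.coord_eq i (x k)]
    ring
  rw [h1]
  split_ifs with hi
  · rw [Finset.sum_eq_single ⟨i, hi⟩]
    · rw [B.coord_vertex i (hF hi) i (hF hi), if_pos rfl, mul_one]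
    · intro k _ hk
      rw [B.coord_vertex i (hF hi) k (hF k.2), if_neg (fun h => hk (Subtype.ext h.symm)), mul_zero]
    · simp
  · exact Finset.sum_eq_zero fun k _ => by rw [B.coord_vertex_of_notMem hF hi k.2, mul_zero]

theorem orderAlong_anti (F : Finset (Fin V)) {s t : ℕ} (h : s ≤ t) :
    orderAlong F t ≤ orderAlong F s := fun _ hq =>
  mem_orderAlong.2 fun m hm => h.trans (mem_orderAlong.1 hq m hm)

/-- A polynomial whose degrees of freedom on the subfaces of a face vanish, vanishes along the
face and its subfaces to the orders given by `smoothness`. -/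
theorem mem_orderAlong_of_functional_eq_zero {cells : Finset (Finset (Fin V))} (hK : K ∈ cells)
    (hcard : K.card = 6) (hx : AffineIndependent ℝ fun i : K => x i) (B : Barycentric x K)
    {ν : (F : Finset (Fin V)) → Fin (6 - F.card) → E} (hν : IsNormalFrame x cells ν)
    {h : ℕ → ℕ → ℝ} (hh : ∀ d ≤ 5, ∀ s ≤ smoothness d, NodalUnisolvent d s (h d s))
    {F₀ : Finset (Fin V)} (hF₀ : F₀ ⊆ K) {q : MvPolynomial (Fin V) ℝ}
    (hq : q.IsHomogeneous 33) (hqK : q ∈ onVars K)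
    (hdof : ∀ δ : Dof cells, δ.face ⊆ F₀ → δ.functional x ν h (B.toPoly q) = 0)
    (F : Finset (Fin V)) (hF : F ⊆ F₀) (hne : F.Nonempty) :
    q ∈ orderAlong F (smoothness (F.card - 1) + 1) := by
  induction F using Finset.strongInduction with
  | H F ih =>
  have hFK : F ⊆ K := hF.trans hF₀
  have hface : IsFace cells F := ⟨hne, K, hK, hFK⟩
  have hFpos : 0 < F.card := hne.card_pos
  have hFcard : F.card ≤ 6 := hcard ▸ Finset.card_le_card hFK
  have hcardF : Fintype.card F = F.card - 1 + 1 := by rw [Fintype.card_coe]; omega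
  suffices H : ∀ s ≤ smoothness (F.card - 1) + 1, q ∈ orderAlong F s from H _ le_rfl
  intro s hs
  induction s with
  | zero => exact mem_orderAlong.2 fun _ _ => Nat.zero_le _
  | succ s ihs =>
    have hqs := ihs (by omega)
    rw [mem_orderAlong]
    intro m hm
    by_contra hlt
    have hms : ∑ i ∈ Fᶜ, m i = s := by
      have := mem_orderAlong.1 hqs m hm
      omega
    set κ : Fin V →₀ ℕ := Finsupp.equivFunOnFinite.symm fun i => if i ∈ F then 0 else m i with hκ
    have hκF : ∀ i ∈ F, κ i = 0 := fun i hi => by simp [hκ, hi]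
    have hκc : ∀ i ∉ F, κ i = m i := fun i hi => by simp [hκ, hi]
    have hκs' : ∑ i ∈ Fᶜ, κ i = s := by
      rw [← hms]
      exact Finset.sum_congr rfl fun i hi => hκc i (Finset.mem_compl.1 hi)
    have hκs : ∑ i, κ i = s := by
      rw [← Finset.sum_compl_add_sum F, Finset.sum_eq_zero hκF, hκs', add_zero]
    have hslice : slice F κ q = 0 := by
      -- Two facts are needed: the exponents of the slice lie in `nodeIndex`, by the vanishing along
      -- the proper subfaces, and the slice is zero at the nodes, by the degrees of freedom on `F`.
      refine (hh (F.card - 1) (by omega) s (by omega)).isUnisolvent hcardF _ ?_ ?_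
      · intro γ hγ
        rw [MvPolynomial.mem_support_iff, coeff_slice hκF] at hγ
        have hsumF : ∑ i ∈ F, glue γ κ i = ∑ i, γ i := by
          rw [← Finset.sum_coe_sort F]
          exact Finset.sum_congr rfl fun i _ => glue_apply_mem γ κ i.2
        refine ⟨?_, fun G hG hG' => ?_⟩
        · have h1 : ∑ i, glue γ κ i = 33 := by
            rw [← hq hγ, ← Finsupp.degree_eq_sum]
            exact DFunLike.congr_fun Finsupp.degree_eq_weight_one _
          rw [← Finset.sum_compl_add_sum F, sum_compl_glue, hκs', hsumF] at h1
          omega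
        · set G' : Finset (Fin V) := G.map (Function.Embedding.subtype _) with hGd
          have hG'F : G' ⊂ F := by
            rw [Finset.ssubset_iff_subset_ne]
            refine ⟨fun i hi => ?_, fun he => hG' (Finset.eq_univ_of_card _ ?_)⟩
            · obtain ⟨k, -, rfl⟩ := Finset.mem_map.1 hi
              exact k.2
            · have hc : G'.card = G.card := Finset.card_map _
              rw [Fintype.card_coe, ← hc, he]
          have h2 := mem_orderAlong.1 (ih G' hG'F (hG'F.1.trans hF) hG.map) _ hγ
          -- The distance to the subface consists of the normal order and the entries inside `F` but
          -- off the subface, exactly the quantity in `nodeIndex`.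
          have h3 : ∑ i ∈ G'ᶜ, glue γ κ i = s + ∑ i ∈ Gᶜ, γ i := by
            have hd : G'ᶜ = Fᶜ ∪ Gᶜ.map (Function.Embedding.subtype _) := by
              ext i
              by_cases hi : i ∈ F <;> simp [hGd, hi]
            rw [hd, Finset.sum_union, sum_compl_glue, hκs', Finset.sum_map]
            · congr 1
              exact Finset.sum_congr rfl fun i _ => glue_apply_mem γ κ i.2
            · rw [Finset.disjoint_left]
              intro i hi hi'
              obtain ⟨k, -, rfl⟩ := Finset.mem_map.1 hi'
              exact Finset.mem_compl.1 hi k.2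
          rw [h3, hGd, Finset.card_map] at h2
          omega
      · intro γ hγ
        set y : E := ∑ i : F, nodeCoord (F.card - 1) s (h (F.card - 1) s) γ i • x i with hy
        have hcoord : ∀ i, B.coord i y = if hi : i ∈ F then
            nodeCoord (F.card - 1) s (h (F.card - 1) s) γ ⟨i, hi⟩ else 0 :=
          B.coord_sum_smul hFK (sum_nodeCoord hcardF _ hγ.1)
        have := B.eval_slice_eq_zero (F := F) (ν := ν F) (y := y)
          (fun i hi => B.exists_dir_decomposition hx hFK hne hcard (hν F hface).1
            (hν F hface).2 hi) (fun i hi => by rw [hcoord, dif_neg hi]) s q hqs hqK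
          (fun β hβ => by
            subst hβ
            exact hdof ⟨F, hface, β, by omega, γ, hγ⟩ hF) κ hκF hκs
        rwa [show (fun i : F => B.coord i y) =
          nodeCoord (F.card - 1) s (h (F.card - 1) s) γ from
            funext fun i => by rw [hcoord, dif_pos i.2]] at this
    refine hm ?_
    have h4 := coeff_slice hκF (Finsupp.equivFunOnFinite.symm fun i : F => m i) q
    rw [hslice, MvPolynomial.coeff_zero] at h4
    rw [h4]
    congr 1
    ext i
    by_cases hi : i ∈ F
    · rw [glue_apply_mem _ _ hi]; rfl
    · rw [glue_apply_notMem _ _ hi, hκc i hi]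

/-- The degrees of freedom on the faces of a cell. -/
noncomputable def localDofs (cells : Finset (Finset (Fin V))) (x : Fin V → E)
    (ν : (F : Finset (Fin V)) → Fin (6 - F.card) → E) (h : ℕ → ℕ → ℝ) (K : Finset (Fin V)) :
    P33 →ₗ[ℝ] ({δ : Dof cells // δ.face ⊆ K} → ℝ) :=
  LinearMap.pi fun δ => δ.1.functional x ν h ∘ₗ P33.subtype

/-- Injectivity is the vanishing argument on the whole cell; surjectivity follows because the number
of functionals equals the dimension of `P33`. -/
theorem localDofs_bijective {cells : Finset (Finset (Fin V))} (hK : K ∈ cells)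
    (hcard : K.card = 6) (hx : AffineIndependent ℝ fun i : K => x i)
    {ν : (F : Finset (Fin V)) → Fin (6 - F.card) → E} (hν : IsNormalFrame x cells ν)
    {h : ℕ → ℕ → ℝ} (hh : ∀ d ≤ 5, ∀ s ≤ smoothness d, NodalUnisolvent d s (h d s)) :
    Function.Bijective (localDofs cells x ν h K) := by
  have hinj : Function.Injective (localDofs cells x ν h K) := by
    rw [injective_iff_map_eq_zero]
    intro p hp
    obtain ⟨B⟩ := nonempty_barycentric hcard hx
    obtain ⟨q, hqp, hq, hqK⟩ :=
      B.exists_homogeneous ((MvPolynomial.mem_restrictTotalDegree _ _ _).1 p.2)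
    have h1 := mem_orderAlong_of_functional_eq_zero hK hcard hx B hν hh subset_rfl hq hqK
      (fun δ hδ => by rw [hqp]; exact congrFun hp ⟨δ, hδ⟩) K subset_rfl
      (Finset.card_pos.1 (by omega))
    have hq0 : q = 0 := by
      ext m
      by_contra hm
      -- On the cell itself the order is at least 1, while no monomial involves a variable off `K`.
      have h2 := mem_orderAlong.1 h1 m hm
      rw [Finset.sum_eq_zero fun i hi => mem_onVars.1 hqK m hm i (Finset.mem_compl.1 hi)] at h2
      omega
    rw [hq0, map_zero] at hqp
    exact Subtype.ext hqp.symm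
  refine ⟨hinj, ?_⟩
  have := Fintype.ofFinite {δ : Dof cells // δ.face ⊆ K}
  refine (LinearMap.injective_iff_surjective_of_finrank_eq_finrank ?_).1 hinj
  rw [finrank_P33, Module.finrank_fintype_fun_eq_card, ← Nat.card_eq_fintype_card,
    card_dof_subset hK hcard]

end Unisolvence

/-! ### Conformity and the nodal basis -/

section Conformity

variable {V : ℕ} {x : Fin V → E} {cells : Finset (Finset (Fin V))}

theorem Dof.dim_le (hcells : ∀ K ∈ cells, K.card = 6) (δ : Dof cells) : δ.dim ≤ 5 := by
  obtain ⟨-, K, hK, hF⟩ := δ.isFace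
  have := Finset.card_le_card hF
  have := hcells K hK
  rw [Dof.dim]
  omega

theorem Dof.card_face (δ : Dof cells) : Fintype.card δ.face = δ.dim + 1 := by
  have := δ.isFace.1.card_pos
  rw [Fintype.card_coe, Dof.dim]
  omega

theorem nodeCoord_pos {τ : Type} [Fintype τ] [DecidableEq τ] {d s : ℕ} {h : ℝ}
    (hτ : Fintype.card τ = d + 1) (hh : IsInternalSpacing d s h) {γ : τ → ℕ}
    (hγ : γ ∈ nodeIndex τ s) (i : τ) : 0 < nodeCoord d s h γ i := by
  have e := Fintype.equivFinOfCardEq hτ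
  have := hh.2 (γ ∘ e.symm) ((mem_nodeIndex_comp_equiv e.symm γ).2 hγ) (e i)
  simpa [nodeCoord] using this

theorem Dof.point_mem_convexHull (hcells : ∀ K ∈ cells, K.card = 6) {h : ℕ → ℕ → ℝ}
    (hh : ∀ d ≤ 5, ∀ s ≤ smoothness d, IsInternalSpacing d s (h d s)) (δ : Dof cells) :
    δ.point x h ∈ convexHull ℝ (x '' (δ.face : Set (Fin V))) := by
  refine (convex_convexHull ℝ _).sum_mem (fun i _ => ?_)
    (sum_nodeCoord δ.card_face _ δ.node_mem.1) fun i _ =>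
      subset_convexHull ℝ _ ⟨i, i.2, rfl⟩
  exact (nodeCoord_pos δ.card_face (hh _ (δ.dim_le hcells) _ δ.order_le) δ.node_mem i).le

/-- In one direction the difference of two polynomials, written in the barycentric coordinates of
one cell, has zero degrees of freedom on the common face and its subfaces, so it vanishes there to
the required order. Conversely, normal derivatives are combinations of partial derivatives, and
internal nodes lie on the closed face. -/
theorem femSpace_eq_superSplineSpace (hcells : ∀ K ∈ cells, K.card = 6)
    (hx : ∀ K ∈ cells, AffineIndependent ℝ fun i : K => x i)
    {ν : (F : Finset (Fin V)) → Fin (6 - F.card) → E} (hν : IsNormalFrame x cells ν)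
    {h : ℕ → ℕ → ℝ} (hint : ∀ d ≤ 5, ∀ s ≤ smoothness d, IsInternalSpacing d s (h d s))
    (hh : ∀ d ≤ 5, ∀ s ≤ smoothness d, NodalUnisolvent d s (h d s)) :
    femSpace x cells ν h = superSplineSpace x cells := by
  ext v
  constructor
  · intro hv F hF K K' hK hK' α hα y hy
    obtain ⟨B⟩ := nonempty_barycentric (hcells K K.2) (hx K K.2)
    obtain ⟨q, hqp, hq, hqK⟩ :=
      B.exists_homogeneous ((MvPolynomial.mem_restrictTotalDegree _ _ _).1 (v K - v K').2)
    have h1 := mem_orderAlong_of_functional_eq_zero K.2 (hcells K K.2) (hx K K.2) B hν hh hK hq hqK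
      (fun δ hδ => by
        rw [hqp, Submodule.coe_sub, map_sub, hv δ K K' (hδ.trans hK) (hδ.trans hK'), sub_self])
      F subset_rfl hF.1
    have h2 := B.evalAt_multiDeriv_toPoly_eq_zero
      (fun i hi => B.coord_eq_zero_of_mem_convexHull hK hy hi)
      (fun i => EuclideanSpace.single i (1 : ℝ)) _ q
      (orderAlong_anti F (Nat.succ_le_succ hα) h1) α rfl
    rw [hqp, Submodule.coe_sub, map_sub, map_sub] at h2
    exact sub_eq_zero.1 h2
  · intro hv δ K K' hK hK'
    refine sub_eq_zero.1 ?_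
    rw [← map_sub]
    refine evalAt_multiDeriv_eq_zero_of_span (v := fun i => EuclideanSpace.single i (1 : ℝ))
      (fun j => ?_) _ _ _ (fun α hα => ?_) δ.normal rfl
    · have : ν δ.face j = ∑ i, ν δ.face j i • EuclideanSpace.single i (1 : ℝ) := by
        ext l
        simp [Finset.sum_apply, Pi.single_apply]
      rw [this]
      exact Submodule.sum_mem _ fun i _ =>
        Submodule.smul_mem _ _ (Submodule.subset_span (Set.mem_range_self i))
    · rw [map_sub, map_sub]
      exact sub_eq_zero.2 (hv δ.face δ.isFace K K' hK hK' α (hα.trans_le δ.order_le) _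
        (δ.point_mem_convexHull hcells hint))

/-- The finite element space has a basis dual to the degrees of freedom. -/
theorem exists_nodal_basis (hcells : ∀ K ∈ cells, K.card = 6)
    (hx : ∀ K ∈ cells, AffineIndependent ℝ fun i : K => x i)
    {ν : (F : Finset (Fin V)) → Fin (6 - F.card) → E} (hν : IsNormalFrame x cells ν)
    {h : ℕ → ℕ → ℝ} (hh : ∀ d ≤ 5, ∀ s ≤ smoothness d, NodalUnisolvent d s (h d s)) :
    ∃ φ : Module.Basis (Dof cells) ℝ (femSpace x cells ν h),
      ∀ (δ δ' : Dof cells) (K : cells), δ.face ⊆ K.1 →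
        (δ = δ' → δ.functional x ν h ((φ δ').1 K : Poly) = 1) ∧
        (δ ≠ δ' → δ.functional x ν h ((φ δ').1 K : Poly) = 0) := by
  classical
  choose cell hcell using fun δ : Dof cells =>
    (⟨⟨_, δ.isFace.2.choose_spec.1⟩, δ.isFace.2.choose_spec.2⟩ : ∃ K : cells, δ.face ⊆ K.1)
  have hbij : ∀ K : cells, Function.Bijective (localDofs cells x ν h K.1) := fun K =>
    localDofs_bijective K.2 (hcells K K.2) (hx K K.2) hν hh
  -- Each degree of freedom is read on one chosen cell; membership in `femSpace` makes the choice
  -- irrelevant. Surjectivity holds because the local solutions of prescribed values agree on shared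
  -- degrees of freedom.
  let T : femSpace x cells ν h →ₗ[ℝ] (Dof cells → ℝ) := LinearMap.pi fun δ =>
    δ.functional x ν h ∘ₗ P33.subtype ∘ₗ LinearMap.proj (cell δ) ∘ₗ
      (femSpace x cells ν h).subtype
  have hT : ∀ (v : femSpace x cells ν h) (δ : Dof cells) (K : cells), δ.face ⊆ K.1 →
      T v δ = δ.functional x ν h (v.1 K : Poly) := fun v δ K hK =>
    v.2 δ (cell δ) K (hcell δ) hK
  have hTbij : Function.Bijective T := by
    constructor
    · rw [injective_iff_map_eq_zero]
      intro v hv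
      refine Subtype.ext (funext fun K => (hbij K).1 ?_)
      refine (funext fun δ => ?_ : localDofs cells x ν h K.1 (v.1 K) = 0).trans (map_zero _).symm
      exact (hT v δ.1 K δ.2).symm.trans (congrFun hv δ.1)
    · intro c
      choose p hp using fun K : cells => (hbij K).2 fun δ => c δ.1
      have hp' : ∀ (δ : Dof cells) (K : cells), δ.face ⊆ K.1 →
          δ.functional x ν h (p K : Poly) = c δ := fun δ K hδ => congrFun (hp K) ⟨δ, hδ⟩
      exact ⟨⟨p, fun δ K K' hK hK' => (hp' δ K hK).trans (hp' δ K' hK').symm⟩,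
        funext fun δ => hp' δ _ (hcell δ)⟩
  let e := LinearEquiv.ofBijective T hTbij
  refine ⟨Module.Basis.ofEquivFun e, fun δ δ' K hK => ?_⟩
  have h1 : δ.functional x ν h ((Module.Basis.ofEquivFun e δ').1 K : Poly) =
      Pi.single (M := fun _ => ℝ) δ' 1 δ := by
    rw [← hT _ δ K hK]
    have : e (Module.Basis.ofEquivFun e δ') = Pi.single δ' 1 := by
      rw [Module.Basis.coe_ofEquivFun, LinearEquiv.apply_symm_apply]
    exact congrFun this δ
  rw [h1]
  exact ⟨fun h => by rw [h, Pi.single_eq_same], fun h => Pi.single_eq_of_ne h _⟩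

end Conformity

/-! ### Global C¹ smoothness -/

section Smoothness

/-- The derivative of a polynomial function. -/
noncomputable def gradAt (p : Poly) (y : E) : E →L[ℝ] ℝ :=
  ∑ i, evalAt y (MvPolynomial.pderiv i p) • (EuclideanSpace.proj i : E →L[ℝ] ℝ)

theorem hasFDerivAt_evalAt (p : Poly) (y : E) :
    HasFDerivAt (fun z => evalAt z p) (gradAt p y) y := by
  have hmul : ∀ (p q : Poly) (z : E), evalAt z (p * q) = evalAt z p * evalAt z q := fun p q z =>
    map_mul (MvPolynomial.aeval fun i => z i) p q
  have hX : ∀ (i : Fin 5) (z : E), evalAt z (MvPolynomial.X i) = z i := fun i z =>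
    MvPolynomial.aeval_X _ _
  induction p using MvPolynomial.induction_on with
  | C a =>
    have h1 : ∀ z : E, evalAt z (MvPolynomial.C a) = a := fun z => MvPolynomial.aeval_C _ _
    simp only [h1]
    refine (hasFDerivAt_const a y).congr_fderiv ?_
    simp [gradAt]
  | add p q hp hq =>
    simp only [map_add]
    refine (hp.add hq).congr_fderiv ?_
    simp [gradAt, add_smul, Finset.sum_add_distrib]
  | mul_X p j hp =>
    simp only [hmul, hX]
    have h2 : HasFDerivAt (fun z : E => z j) (EuclideanSpace.proj j : E →L[ℝ] ℝ) y :=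
      (EuclideanSpace.proj j : E →L[ℝ] ℝ).hasFDerivAt
    refine (hp.mul h2).congr_fderiv ?_
    simp only [gradAt, MvPolynomial.pderiv_mul, map_add, hmul, hX, add_smul,
      Finset.sum_add_distrib, Finset.smul_sum, smul_smul]
    rw [add_comm]
    congr 1
    · exact Finset.sum_congr rfl fun i _ => by rw [mul_comm]
    · symm
      rw [Finset.sum_eq_single j]
      · rw [MvPolynomial.pderiv_X_self]
        simp [evalAt]
      · intro i _ hi
        rw [MvPolynomial.pderiv_X_of_ne hi.symm, map_zero, mul_zero, zero_smul]
      · simp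

theorem continuous_gradAt (p : Poly) : Continuous (gradAt p) := by
  have : ∀ q : Poly, Continuous fun y : E => evalAt y q := fun q =>
    continuous_iff_continuousAt.2 fun y => (hasFDerivAt_evalAt q y).continuousAt
  exact continuous_finsetSum _ fun i _ => (this _).smul continuous_const

theorem hasFDerivWithinAt_biUnion {α : Type*} (S : Finset α) (D : α → Set E)
    {u : E → ℝ} {u' : E →L[ℝ] ℝ} {y : E} (hu : ∀ K ∈ S, HasFDerivWithinAt u u' (D K) y) :
    HasFDerivWithinAt u u' (⋃ K ∈ S, D K) y := by
  classical
  induction S using Finset.induction_on with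
  | empty => simp
  | insert K S _ ih =>
    rw [Finset.set_biUnion_insert]
    exact (hu K (Finset.mem_insert_self K S)).union
      (ih fun K' hK' => hu K' (Finset.mem_insert_of_mem hK'))

variable {V : ℕ} {x : Fin V → E} {cells : Finset (Finset (Fin V))}

/-- Where cells meet, their polynomials agree in value and gradient. The pieces therefore define one
function and one gradient field, continuous on a finite closed cover. -/
theorem exists_contDiffOn (hgrid : IsSimplexGrid x cells) {v : Piecewise cells}
    (hv : v ∈ superSplineSpace x cells) :
    ∃ u : E → ℝ,
      (∀ K : cells, ∀ y ∈ convexHull ℝ (x '' (K.1 : Set (Fin V))), u y = evalAt y (v K : Poly)) ∧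
      ContDiffOn ℝ 1 u (domain x cells) := by
  classical
  set D : Finset (Fin V) → Set E := fun K => convexHull ℝ (x '' (K : Set (Fin V))) with hD
  have hclosed : ∀ K, IsClosed (D K) := fun K =>
    ((K.finite_toSet.image x).isCompact_convexHull ℝ).isClosed
  have hagree : ∀ K K' : cells, ∀ y ∈ D K.1, y ∈ D K'.1 →
      ∀ α : Fin 5 → ℕ, ∑ i, α i ≤ 1 →
        evalAt y (partialDeriv α (v K : Poly)) = evalAt y (partialDeriv α (v K' : Poly)) := by
    intro K K' y hy hy' α hα
    by_cases hKK : K = K'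
    · rw [hKK]
    have hy2 : y ∈ convexHull ℝ (x '' ((K.1 ∩ K'.1 : Finset (Fin V)) : Set (Fin V))) := by
      rw [← hgrid.inter_eq K K.2 K' K'.2]
      exact ⟨hy, hy'⟩
    have hne : (K.1 ∩ K'.1).Nonempty := by
      by_contra h
      rw [Finset.not_nonempty_iff_eq_empty.1 h] at hy2
      simp at hy2
    have hcard : (K.1 ∩ K'.1).card < 6 := by
      have h1 := hgrid.card_eq K K.2
      have h2 := hgrid.card_eq K' K'.2
      rw [← h1]
      refine Finset.card_lt_card (Finset.ssubset_iff_subset_ne.2 ⟨Finset.inter_subset_left,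
        fun h => hKK (Subtype.ext ?_)⟩)
      exact Finset.eq_of_subset_of_card_le (Finset.inter_eq_left.1 h) (by rw [h1, h2])
    refine hv _ ⟨hne, K, K.2, Finset.inter_subset_left⟩ K K' Finset.inter_subset_left
      Finset.inter_subset_right α (hα.trans ?_) y hy2
    have := hne.card_pos
    generalize (K.1 ∩ K'.1).card = c at *
    -- The intersection of distinct cells has at most five vertices, and up to dimension 4 the
    -- smoothness is at least 1. In dimension 5 it would be 0.
    interval_cases c <;> simp [smoothness]
  have hval : ∀ K K' : cells, ∀ y ∈ D K.1, y ∈ D K'.1 →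
      evalAt y (v K : Poly) = evalAt y (v K' : Poly) := by
    intro K K' y hy hy'
    have := hagree K K' y hy hy' 0 (by simp)
    rwa [partialDeriv, multiDeriv_zero] at this
  have hgrad : ∀ K K' : cells, ∀ y ∈ D K.1, y ∈ D K'.1 →
      gradAt (v K : Poly) y = gradAt (v K' : Poly) y := by
    intro K K' y hy hy'
    refine Finset.sum_congr rfl fun i _ => ?_
    have := hagree K K' y hy hy' (0 + Pi.single i 1) (by rw [sum_add_single]; simp)
    rw [partialDeriv, multiDeriv_add_single, multiDeriv_zero, one_mul] at this
    have hd : ∀ p : Poly, dirDeriv (EuclideanSpace.single i (1 : ℝ)) p =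
        MvPolynomial.pderiv i p := by
      intro p
      rw [dirDeriv_apply, Finset.sum_eq_single i]
      · simp
      · intro j _ hj
        simp [hj]
      · simp
    rw [hd, hd] at this
    rw [this]
  set u : E → ℝ := fun y => if h : ∃ K : cells, y ∈ D K.1 then evalAt y (v h.choose : Poly) else 0
    with hu
  set u' : E → E →L[ℝ] ℝ := fun y =>
    if h : ∃ K : cells, y ∈ D K.1 then gradAt (v h.choose : Poly) y else 0 with hu'
  have hu_eq : ∀ K : cells, ∀ y ∈ D K.1, u y = evalAt y (v K : Poly) := by
    intro K y hy
    have h : ∃ K : cells, y ∈ D K.1 := ⟨K, hy⟩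
    rw [hu]
    simp only [dif_pos h]
    exact hval _ _ y h.choose_spec hy
  have hu'_eq : ∀ K : cells, ∀ y ∈ D K.1, u' y = gradAt (v K : Poly) y := by
    intro K y hy
    have h : ∃ K : cells, y ∈ D K.1 := ⟨K, hy⟩
    rw [hu']
    simp only [dif_pos h]
    exact hgrad _ _ y h.choose_spec hy
  refine ⟨u, hu_eq, ?_⟩
  have hder : ∀ y ∈ domain x cells, HasFDerivWithinAt u (u' y) (domain x cells) y := by
    intro y _
    refine hasFDerivWithinAt_biUnion cells D fun K hK => ?_
    by_cases hy : y ∈ D K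
    · rw [hu'_eq ⟨K, hK⟩ y hy]
      exact (hasFDerivAt_evalAt _ y).hasFDerivWithinAt.congr (fun z hz => hu_eq ⟨K, hK⟩ z hz)
        (hu_eq ⟨K, hK⟩ y hy)
    -- A closed cell that misses `y` imposes no condition near `y`.
    · exact HasFDerivWithinAt.of_notMem_closure (by rwa [(hclosed K).closure_eq])
  have hcont : ContinuousOn u' (domain x cells) := by
    have hdom : domain x cells = ⋃ K : cells, D K.1 := by
      ext y
      simp [domain, hD]
    rw [hdom]
    exact (locallyFinite_of_finite _).continuousOn_iUnion (fun K => hclosed K.1) fun K =>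
      (continuous_gradAt _).continuousOn.congr (hu'_eq K)
  rw [← zero_add (1 : WithTop ℕ∞), contDiffOn_succ_iff_hasFDerivWithinAt (by simp)]
  intro y hy
  exact ⟨domain x cells, by rw [Set.insert_eq_of_mem hy]; exact self_mem_nhdsWithin, by simp, u',
    hder, contDiffOn_zero.2 hcont⟩

end Smoothness

/-! ### Exceptional spacings and the main theorem -/

/-- The exceptional spacings. -/
noncomputable def exceptionalSpacings (d s : ℕ) : Finset ℝ :=
  if d ≤ 1 ∨ d = 2 ∧ s ≤ 1 then ∅ else (finite_not_nodalUnisolvent d s).toFinset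

theorem nodalUnisolvent_of_notMem {d s : ℕ} (hs : s ≤ smoothness d) {h : ℝ}
    (hint : IsInternalSpacing d s h) (hh : h ∉ exceptionalSpacings d s) :
    NodalUnisolvent d s h := by
  by_cases hd : d ≤ 1 ∨ d = 2 ∧ s ≤ 1
  · rcases hd with hd | ⟨rfl, hs1⟩
    · interval_cases d
      · refine nodalUnisolvent_of_full (a := 0) hint fun γ => ?_
        obtain ⟨a, rfl⟩ : ∃ a, γ = ![a] := ⟨γ 0, by ext i; fin_cases i; rfl⟩
        rw [mem_nodeIndex_fin]
        simp only [faceCondition_cons, faceCondition_empty]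
        simp
      · exact nodalUnisolvent_of_full (a := 17 - s) hint fun γ => mem_nodeIndex_two γ
    · refine nodalUnisolvent_of_full (a := 9 - s) hint fun γ => ?_
      have h1 : ∀ i, γ i + ∑ j ∈ Finset.univ.erase i, γ j = ∑ i, γ i := fun i =>
        Finset.add_sum_erase _ γ (Finset.mem_univ i)
      have h2 : ∀ i, (∀ j, 9 - s ≤ γ j) → 2 * (9 - s) ≤ ∑ j ∈ Finset.univ.erase i, γ j :=
        fun i h => by simpa using Finset.card_nsmul_le_sum (Finset.univ.erase i) γ _ fun j _ => h j
      rw [mem_nodeIndex_three (hs1.trans (by norm_num))]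
      refine and_congr_right fun h => ⟨fun h3 i => (h3 i).1, fun h3 i => ⟨h3 i, ?_⟩⟩
      -- For s ≤ 1 the upper bound 16 is automatic: if the other two entries are at least 9 - s, the
      -- third is at most 15 + s. The triangle then carries a full lattice.
      have h4 : ∑ i, γ i = 33 - s := h
      have h5 := h1 i
      have h6 := h2 i h3
      have h7 : 9 - s ≥ 8 := by omega
      clear h1 h2 h3
      omega
  · rw [exceptionalSpacings, if_neg hd, Set.Finite.mem_toFinset] at hh
    simpa using hh

end SimplexFE

theorem mainTheorem1 :
    -- numbers of nodes on one face, for each dimension and order of the normal derivative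
    ((∀ s ≤ 16, (nodeIndex (Fin 1) s).ncard = 1) ∧
      (∀ s ≤ 8, (nodeIndex (Fin 2) s).ncard = s) ∧
      (nodeIndex (Fin 3) 0).ncard = 28 ∧ (nodeIndex (Fin 3) 1).ncard = 45 ∧
      (nodeIndex (Fin 3) 2).ncard = 63 ∧ (nodeIndex (Fin 3) 3).ncard = 82 ∧
      (nodeIndex (Fin 3) 4).ncard = 102 ∧
      (nodeIndex (Fin 4) 0).ncard = 544 ∧ (nodeIndex (Fin 4) 1).ncard = 889 ∧
      (nodeIndex (Fin 4) 2).ncard = 1268 ∧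
      (nodeIndex (Fin 5) 0).ncard = 6965 ∧ (nodeIndex (Fin 5) 1).ncard = 12990 ∧
      (nodeIndex (Fin 6) 0).ncard = 62888) ∧
    -- numbers of degrees of freedom of one simplex, by the dimension of the face
    ({δ : Dof oneCell | δ.dim = 0}.ncard = 122094 ∧
      {δ : Dof oneCell | δ.dim = 1}.ncard = 47520 ∧
      {δ : Dof oneCell | δ.dim = 2}.ncard = 57820 ∧
      {δ : Dof oneCell | δ.dim = 3}.ncard = 91890 ∧
      {δ : Dof oneCell | δ.dim = 4}.ncard = 119730 ∧
      {δ : Dof oneCell | δ.dim = 5}.ncard = 62888 ∧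
      Nat.card (Dof oneCell) = 501942 ∧
      Nat.choose 38 5 = 501942 ∧
      Module.finrank ℝ P33 = 501942) ∧
    -- for every choice of internal lattices, up to finitely many exceptional spacings
    ∃ Z : ℕ → ℕ → Finset ℝ,
      (∀ s, Z 0 s = ∅) ∧ (∀ s, Z 1 s = ∅) ∧ Z 2 0 = ∅ ∧ Z 2 1 = ∅ ∧
      ∀ h : ℕ → ℕ → ℝ,
        (∀ d ≤ 5, ∀ s ≤ smoothness d, IsInternalSpacing d s (h d s) ∧ h d s ∉ Z d s) →
        -- unisolvence on each simplex
        (∀ x : Fin 6 → E, AffineIndependent ℝ x →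
          ∀ ν : (F : Finset (Fin 6)) → Fin (6 - F.card) → E, IsNormalFrame x oneCell ν →
            ∀ c : Dof oneCell → ℝ, ∃! p : P33, ∀ δ, δ.functional x ν h (p : Poly) = c δ) ∧
        -- conformity, smoothness, and the nodal basis on each grid
        (∀ (V : ℕ) (x : Fin V → E) (cells : Finset (Finset (Fin V))), IsSimplexGrid x cells →
          ∀ ν : (F : Finset (Fin V)) → Fin (6 - F.card) → E, IsNormalFrame x cells ν →
            femSpace x cells ν h = superSplineSpace x cells ∧
            (∀ v ∈ femSpace x cells ν h, ∃ u : E → ℝ,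
              (∀ K : cells, ∀ y ∈ convexHull ℝ (x '' (K.1 : Set (Fin V))),
                u y = evalAt y (v K : Poly)) ∧
              ContDiffOn ℝ 1 u (domain x cells)) ∧
            ∃ φ : Module.Basis (Dof cells) ℝ (femSpace x cells ν h),
              ∀ (δ δ' : Dof cells) (K : cells), δ.face ⊆ K.1 →
                (δ = δ' → δ.functional x ν h ((φ δ').1 K : Poly) = 1) ∧
                (δ ≠ δ' → δ.functional x ν h ((φ δ').1 K : Poly) = 0)) := by
  refine ⟨⟨fun s _ => ncard_nodeIndex_one s, fun s hs => ncard_nodeIndex_two hs, ?_⟩,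
    ⟨?_, ?_, ?_, ?_, ?_, ?_, card_dof_oneCell, by decide +kernel, finrank_P33⟩, exceptionalSpacings,
    fun s => ?_, fun s => ?_, ?_, ?_, fun h hh => ?_⟩
  · refine ⟨?_, ?_, ?_, ?_, ?_, ?_, ?_, ?_, ncard_nodeIndex_five_zero, ncard_nodeIndex_five_one,
      ncard_nodeIndex_six⟩
    all_goals first
      | rw [ncard_nodeIndex_three (by norm_num)]; decide +kernel
      | rw [ncard_nodeIndex_four (by norm_num)]; decide +kernel
  · rw [ncard_dof_dim, faceCount_one]; decide +kernel
  · rw [ncard_dof_dim, faceCount_two]; decide +kernel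
  · rw [ncard_dof_dim, faceCount_three]; decide +kernel
  · rw [ncard_dof_dim, faceCount_four]; decide +kernel
  · rw [ncard_dof_dim, faceCount_five]; decide +kernel
  · rw [ncard_dof_dim, faceCount_six]; decide +kernel
  · simp [exceptionalSpacings]
  · simp [exceptionalSpacings]
  · simp [exceptionalSpacings]
  · simp [exceptionalSpacings]
  have hint : ∀ d ≤ 5, ∀ s ≤ smoothness d, IsInternalSpacing d s (h d s) :=
    fun d hd s hs => (hh d hd s hs).1
  have hnodal : ∀ d ≤ 5, ∀ s ≤ smoothness d, NodalUnisolvent d s (h d s) :=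
    fun d hd s hs => nodalUnisolvent_of_notMem hs (hint d hd s hs) (hh d hd s hs).2
  refine ⟨fun x hx ν hν c => ?_, fun V x cells hgrid ν hν => ?_⟩
  · have hbij := localDofs_bijective (cells := oneCell) (Finset.mem_singleton_self Finset.univ)
      (by simp) (hx.comp_embedding (Function.Embedding.subtype _)) hν hnodal
    obtain ⟨p, hp⟩ := hbij.2 fun δ => c δ.1
    refine ⟨p, fun δ => congrFun hp ⟨δ, Finset.subset_univ _⟩, fun p' hp' => hbij.1 ?_⟩
    rw [hp]
    exact funext fun δ => hp' δ.1
  · have heq := femSpace_eq_superSplineSpace hgrid.card_eq hgrid.affineIndependent hν hint hnodal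
    exact ⟨heq, fun v hv => exists_contDiffOn hgrid (heq ▸ hv),
      exists_nodal_basis hgrid.card_eq hgrid.affineIndependent hν hnodal⟩
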